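/- For a locally integrable function $\phi:\mathbb R\to\mathbb C$ put $$\|\phi\|_{B_1^{\#}}=\int_{-\infty}^{\infty}\int_{-\infty}^{\infty}\frac{|\phi(x+2t)-2\phi(x+t)+\phi(x)|}{t^2}\,dx\,dt,\qquad \|\phi\|_{\rm BMO}=\sup_{I}\frac1{|I|}\int_I|\phi(x)-\phi_I|\,dx,$$ where $I$ runs over the bounded intervals of $\mathbb R$ and $\phi_I$ is the mean of $\phi$ over $I$. Let $\widehat B_1(\mathbb R)$ be the complex space of all $\phi$ for which both quantities are finite, modulo functions that are constant almost everywhere, with the norm $\|\phi\|_{\widehat B_1}=\|\phi\|_{B_1^{\#}}+\|\phi\|_{\rm BMO}$. Let $\dot W^1_1(\mathbb R)$ be the space of locally integrable $\phi:\mathbb R\to\mathbb C$ whose distributional derivative $\phi'$ is integrable, with the semi-norm $\|\phi\|_{\dot W^1_1}=\|\phi'\|_{L_1}$. An orientation-preserving homeomorphism $h:\mathbb R\to\mathbb R$ is quasisymmetric if there is a constant $M>1$ such that $|h(I)|\le M\,|h(\tfrac12 I)|$ for every bounded interval $I$, where $\tfrac12 I$ is the interval with the same center and half the length. **Theorem.**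 Let $h:\mathbb R\to\mathbb R$ be a quasisymmetric homeomorphism that is locally absolutely continuous, with $h'>0$ almost everywhere and $\log h'\in\dot W^1_1(\mathbb R)$. Then the composition operator $C_h(\phi)=\phi\circ h$ is well defined on $\widehat B_1(\mathbb R)$ and is a Banach automorphism of it, that is, a linear bijection of $\widehat B_1(\mathbb R)$ onto itself which is bounded together with its inverse. Its operator norm is bounded by a constant that depends only on $\|\log h'\|_{\dot W^1_1}$, and it tends to $1$ as $\|\log h'\|_{\dot W^1_1}\to0$. More precisely, there is a function $K:[0,\infty)\to\mathbb R$ with $K(s)\to1$ as $s\to0$ such that for every such $h$, $$K\big(\|\log h'\|_{\dot W^1_1}\big)^{-1}\le\|C_h\|\le K\big(\|\log h'\|_{\dot W^1_1}\big).$$ -/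

import Mathlib

open MeasureTheory Set Filter Topology
open scoped ENNReal ContDiff

/-- The second-difference Besov seminorm
`‖φ‖_{B_1^#} = ∫ ∫ |φ (x + 2t) - 2 φ (x + t) + φ x| / t² dx dt`, with values in `[0, ∞]`. -/
noncomputable def besovSharpNorm (φ : ℝ → ℂ) : ℝ≥0∞ :=
  ∫⁻ t : ℝ, ∫⁻ x : ℝ, ‖φ (x + 2 * t) - 2 * φ (x + t) + φ x‖ₑ / ENNReal.ofReal (t ^ 2)

/-- The `BMO` seminorm: the supremum over all bounded intervals `I` of the mean over `I` of
`|φ - φ_I|`, where `φ_I` is the mean of `φ` over `I`; with values in `[0, ∞]`. -/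
noncomputable def bmoNorm (φ : ℝ → ℂ) : ℝ≥0∞ :=
  ⨆ (a : ℝ) (b : ℝ) (_ : a < b),
    (∫⁻ x in Icc a b, ‖φ x - ⨍ y in Icc a b, φ y‖ₑ) / ENNReal.ofReal (b - a)

/-- The seminorm `‖φ‖_{B_1^#} + ‖φ‖_{BMO}`, with values in `[0, ∞]`. -/
noncomputable def besovHatNorm (φ : ℝ → ℂ) : ℝ≥0∞ :=
  besovSharpNorm φ + bmoNorm φ

/-- `φ` is locally integrable and belongs to `B_1^#(ℝ) ∩ BMO(ℝ)`. -/
def MemBesovHat (φ : ℝ → ℂ) : Prop :=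
  LocallyIntegrable φ ∧ besovSharpNorm φ < ⊤ ∧ bmoNorm φ < ⊤

theorem besovSharpNorm_zero : besovSharpNorm 0 = 0 := by
  simp [besovSharpNorm]

theorem bmoNorm_zero : bmoNorm 0 = 0 := by
  simp [bmoNorm]

theorem besovSharpNorm_smul (c : ℂ) (φ : ℝ → ℂ) :
    besovSharpNorm (c • φ) = ‖c‖ₑ * besovSharpNorm φ := by
  unfold besovSharpNorm
  rw [← lintegral_const_mul' _ _ enorm_ne_top]
  refine lintegral_congr fun t => ?_
  rw [← lintegral_const_mul' _ _ enorm_ne_top]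
  refine lintegral_congr fun x => ?_
  rw [← mul_div_assoc, ← enorm_mul]
  congr 2
  simp only [Pi.smul_apply, smul_eq_mul]
  ring

theorem bmoNorm_smul (c : ℂ) (φ : ℝ → ℂ) : bmoNorm (c • φ) = ‖c‖ₑ * bmoNorm φ := by
  unfold bmoNorm
  simp only [ENNReal.mul_iSup]
  refine iSup_congr fun a => iSup_congr fun b => iSup_congr fun _ => ?_
  rw [← mul_div_assoc, ← lintegral_const_mul' _ _ enorm_ne_top]
  congr 1
  refine lintegral_congr fun x => ?_
  rw [← enorm_mul]
  congr 1
  simp only [Pi.smul_apply, average_eq, smul_eq_mul, integral_const_mul, Complex.real_smul]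
  ring

theorem measurable_secondDifference {ψ : ℝ → ℂ} (hψ : Measurable ψ) :
    Measurable fun p : ℝ × ℝ =>
      ‖ψ (p.2 + 2 * p.1) - 2 * ψ (p.2 + p.1) + ψ p.2‖ₑ / ENNReal.ofReal (p.1 ^ 2) := by
  fun_prop

theorem secondDifference_ae_congr {φ ψ : ℝ → ℂ} (h : φ =ᵐ[volume] ψ) (t : ℝ) :
    ∀ᵐ x : ℝ, φ (x + 2 * t) - 2 * φ (x + t) + φ x = ψ (x + 2 * t) - 2 * ψ (x + t) + ψ x := by
  have h1 : ∀ s : ℝ, ∀ᵐ x : ℝ, φ (x + s) = ψ (x + s) := fun s =>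
    (measurePreserving_add_right volume s).quasiMeasurePreserving.ae h
  filter_upwards [h, h1 t, h1 (2 * t)] with x hx h2 h3
  rw [hx, h2, h3]

theorem besovSharpNorm_congr {φ ψ : ℝ → ℂ} (h : φ =ᵐ[volume] ψ) :
    besovSharpNorm φ = besovSharpNorm ψ := by
  refine lintegral_congr fun t => lintegral_congr_ae ?_
  filter_upwards [secondDifference_ae_congr h t] with x hx
  rw [hx]

theorem besovSharpNorm_add_le {φ ψ : ℝ → ℂ} (hφ : AEMeasurable φ) (hψ : AEMeasurable ψ) :
    besovSharpNorm (φ + ψ) ≤ besovSharpNorm φ + besovSharpNorm ψ := by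
  rw [besovSharpNorm_congr hφ.ae_eq_mk, besovSharpNorm_congr hψ.ae_eq_mk,
    besovSharpNorm_congr (hφ.ae_eq_mk.add hψ.ae_eq_mk)]
  have mφ := measurable_secondDifference hφ.measurable_mk
  have mψ := measurable_secondDifference hψ.measurable_mk
  unfold besovSharpNorm
  rw [← lintegral_add_left mφ.lintegral_prod_right']
  refine lintegral_mono fun t => ?_
  refine le_trans (lintegral_mono fun x => ?_)
    (lintegral_add_left (mφ.comp (measurable_prodMk_left (x := t))) _).le
  simp only [Function.comp_apply]
  rw [← ENNReal.add_div]
  gcongr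
  refine le_trans (le_of_eq ?_) (enorm_add_le _ _)
  congr 1
  simp only [Pi.add_apply]
  ring

theorem bmoNorm_add_le {φ ψ : ℝ → ℂ} (hφ : LocallyIntegrable φ) (hψ : LocallyIntegrable ψ) :
    bmoNorm (φ + ψ) ≤ bmoNorm φ + bmoNorm ψ := by
  refine iSup_le fun a => iSup_le fun b => iSup_le fun hab => ?_
  have iφ : IntegrableOn φ (Icc a b) := hφ.integrableOn_isCompact isCompact_Icc
  have iψ : IntegrableOn ψ (Icc a b) := hψ.integrableOn_isCompact isCompact_Icc
  have key : (∫⁻ x in Icc a b, ‖(φ + ψ) x - ⨍ y in Icc a b, (φ + ψ) y‖ₑ) ≤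
      (∫⁻ x in Icc a b, ‖φ x - ⨍ y in Icc a b, φ y‖ₑ) +
        ∫⁻ x in Icc a b, ‖ψ x - ⨍ y in Icc a b, ψ y‖ₑ := by
    refine le_trans (lintegral_mono fun x => ?_) (lintegral_add_left'
      (iφ.aestronglyMeasurable.sub aestronglyMeasurable_const).enorm _).le
    refine le_trans (le_of_eq ?_) (enorm_add_le _ _)
    congr 1
    simp only [Pi.add_apply, Pi.sub_apply, average_eq, integral_add iφ iψ, smul_add]
    ring
  refine (ENNReal.div_le_div_right key _).trans ?_
  rw [ENNReal.add_div]
  refine add_le_add ?_ ?_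
  · exact le_iSup_of_le a (le_iSup_of_le b (le_iSup_of_le hab le_rfl))
  · exact le_iSup_of_le a (le_iSup_of_le b (le_iSup_of_le hab le_rfl))

theorem besovHatNorm_add_le {φ ψ : ℝ → ℂ} (hφ : LocallyIntegrable φ)
    (hψ : LocallyIntegrable ψ) : besovHatNorm (φ + ψ) ≤ besovHatNorm φ + besovHatNorm ψ := by
  unfold besovHatNorm
  refine (add_le_add (besovSharpNorm_add_le hφ.aestronglyMeasurable.aemeasurable
    hψ.aestronglyMeasurable.aemeasurable) (bmoNorm_add_le hφ hψ)).trans (le_of_eq ?_)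
  ring

theorem besovHatNorm_smul (c : ℂ) (φ : ℝ → ℂ) :
    besovHatNorm (c • φ) = ‖c‖ₑ * besovHatNorm φ := by
  rw [besovHatNorm, besovHatNorm, besovSharpNorm_smul, bmoNorm_smul, mul_add]

/-- The complex vector space of all functions `φ : ℝ → ℂ` with `MemBesovHat φ`. -/
def besovHatSubmodule : Submodule ℂ (ℝ → ℂ) where
  carrier := {φ | MemBesovHat φ}
  zero_mem' := ⟨locallyIntegrable_zero, by simp [besovSharpNorm_zero], by simp [bmoNorm_zero]⟩
  add_mem' := fun {φ ψ} hφ hψ => ⟨hφ.1.add hψ.1,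
    (besovSharpNorm_add_le hφ.1.aestronglyMeasurable.aemeasurable
      hψ.1.aestronglyMeasurable.aemeasurable).trans_lt (ENNReal.add_lt_top.2 ⟨hφ.2.1, hψ.2.1⟩),
    (bmoNorm_add_le hφ.1 hψ.1).trans_lt (ENNReal.add_lt_top.2 ⟨hφ.2.2, hψ.2.2⟩)⟩
  smul_mem' := fun c φ hφ => ⟨hφ.1.smul c,
    by rw [besovSharpNorm_smul]; exact ENNReal.mul_lt_top enorm_lt_top hφ.2.1,
    by rw [bmoNorm_smul]; exact ENNReal.mul_lt_top enorm_lt_top hφ.2.2⟩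

/-- The functions of the space `B̂₁(ℝ)`, before identification modulo constants. It is a copy of
`besovHatSubmodule`, so that it carries the seminorm below and not the topology of pointwise
convergence. -/
def BesovHatFun : Type := besovHatSubmodule

noncomputable instance : AddCommGroup BesovHatFun :=
  inferInstanceAs (AddCommGroup besovHatSubmodule)

noncomputable instance : Module ℂ BesovHatFun :=
  inferInstanceAs (Module ℂ besovHatSubmodule)

/-- The function `φ`, seen as an element of `BesovHatFun`. -/
def BesovHatFun.of (φ : ℝ → ℂ) (hφ : MemBesovHat φ) : BesovHatFun := ⟨φ, hφ⟩

/-- The function underlying an element of `BesovHatFun`. -/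
def BesovHatFun.toFun (φ : BesovHatFun) : ℝ → ℂ := φ.1

theorem BesovHatFun.mem (φ : BesovHatFun) : MemBesovHat φ.toFun := φ.2

theorem BesovHatFun.besovHatNorm_ne_top (φ : BesovHatFun) : besovHatNorm φ.toFun ≠ ⊤ :=
  (ENNReal.add_lt_top.2 φ.mem.2).ne

/-- The seminorm `‖φ‖_{B_1^#} + ‖φ‖_{BMO}` on the functions of `B̂₁(ℝ)`. -/
noncomputable def besovHatSeminorm : Seminorm ℂ BesovHatFun :=
  Seminorm.of (fun φ => (besovHatNorm φ.toFun).toReal)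
    (fun φ ψ => by
      rw [← ENNReal.toReal_add φ.besovHatNorm_ne_top ψ.besovHatNorm_ne_top]
      exact ENNReal.toReal_mono
        (ENNReal.add_ne_top.2 ⟨φ.besovHatNorm_ne_top, ψ.besovHatNorm_ne_top⟩)
        (besovHatNorm_add_le φ.mem.1 ψ.mem.1))
    (fun c φ => by
      change (besovHatNorm (c • φ.toFun)).toReal = _
      rw [besovHatNorm_smul, ENNReal.toReal_mul, toReal_enorm])

noncomputable instance : SeminormedAddCommGroup BesovHatFun :=
  besovHatSeminorm.toAddGroupSeminorm.toSeminormedAddCommGroup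

noncomputable instance : NormedSpace ℂ BesovHatFun where
  norm_smul_le c φ := (map_smul_eq_mul besovHatSeminorm c φ).le

/-- The space `B̂₁(ℝ)`: the quotient of the functions in `B_1^#(ℝ) ∩ BMO(ℝ)` by those of seminorm
zero (the functions that are constant almost everywhere), with the norm
`‖φ‖_{B_1^#} + ‖φ‖_{BMO}`. -/
abbrev BesovHat : Type := SeparationQuotient BesovHatFun

/-- The class in `B̂₁(ℝ)` of a function `φ`. -/
noncomputable def BesovHat.mk (φ : ℝ → ℂ) (hφ : MemBesovHat φ) : BesovHat :=
  SeparationQuotient.mk (BesovHatFun.of φ hφ)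

/-- The norm of `B̂₁(ℝ)` is `‖φ‖_{B_1^#} + ‖φ‖_{BMO}`. -/
theorem BesovHat.norm_mk (φ : ℝ → ℂ) (hφ : MemBesovHat φ) :
    ‖BesovHat.mk φ hφ‖ = (besovSharpNorm φ + bmoNorm φ).toReal := rfl

/-- The locally integrable function `g` is the distributional derivative of `φ` on `ℝ`. -/
def IsWeakDeriv (φ g : ℝ → ℂ) : Prop :=
  LocallyIntegrable g ∧ ∀ ψ : ℝ → ℝ, ContDiff ℝ ∞ ψ → HasCompactSupport ψ →
    ∫ x, deriv ψ x • φ x = -∫ x, ψ x • g x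

/-- The homogeneous Sobolev space `Ẇ¹₁(ℝ)`: locally integrable functions whose distributional
derivative is an integrable function. -/
def MemSobolevDot (φ : ℝ → ℂ) : Prop :=
  LocallyIntegrable φ ∧ ∃ g : ℝ → ℂ, IsWeakDeriv φ g ∧ Integrable g

/-- The seminorm `‖φ'‖_{L¹}` of `Ẇ¹₁(ℝ)`. The distributional derivative is unique up to null sets,
so the infimum is over equal values; it is `∞` if the distributional derivative is not a locally
integrable function. -/
noncomputable def sobolevDotNorm (φ : ℝ → ℂ) : ℝ≥0∞ :=
  ⨅ (g : ℝ → ℂ) (_ : IsWeakDeriv φ g), ∫⁻ x, ‖g x‖ₑ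

/-- A quasisymmetric homeomorphism of `ℝ`: it preserves the orientation and satisfies the doubling
condition `|h(I)| ≤ M |h(½I)|` with a constant `M > 1` for all bounded intervals
`I = [c - r, c + r]`. -/
def IsQuasisymmetric (h : ℝ ≃ₜ ℝ) : Prop :=
  StrictMono h ∧ ∃ M : ℝ, 1 < M ∧ ∀ c r : ℝ, 0 < r →
    h (c + r) - h (c - r) ≤ M * (h (c + r / 2) - h (c - r / 2))

/-- `h` is absolutely continuous on every bounded interval. -/
def IsLocallyAbsolutelyContinuous (h : ℝ → ℝ) : Prop :=
  ∀ a b : ℝ, AbsolutelyContinuousOnInterval h a b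

/-- The function `log h'`, regarded as complex valued. -/
noncomputable def logDerivative (h : ℝ → ℝ) : ℝ → ℂ :=
  fun x => (Real.log (deriv h x) : ℂ)

/-! Since `log h'` has an integrable derivative, it agrees almost everywhere with a continuous `u`
whose total variation is at most `V = ‖log h'‖`. Hence `h` is a `C¹` diffeomorphism with `m ≤ h' ≤
e^V m` for some `m > 0`. The inverse is of the same kind with the same `V`, so it suffices to bound
`φ ∘ h`. The variation of `u` is recorded through a measure `μ` because measures are easily halved
and pushed forward.

The `BMO` part is a change of variables (`bmoNorm_comp_le`). For the Besov part suppose first that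
`e^V ≤ 3/2` and that `ψ` is continuous and of bounded variation. In the second difference of `ψ ∘ h`
the value at `h x` is replaced by the value at `2 h(x+t) - h(x+2t)`, the reflection of `h(x+2t)` in
`h(x+t)`. What results is a true second difference of `ψ`, and changing both variables costs only
`e^{2V}` (`lintegral_symmetric_secondDiff_le`). The error compares `ψ` at `h x` and at the reflected
point. By Fubini it is at most a constant times `Var ψ` times the integral in `dt/t²` of a second
difference of `h` at a fixed point, an integral controlled by `μ`
(`lintegral_enorm_sub_reflected_le`, `lintegral_secondDiff_le`). So the error is `O(V) Var ψ`.

It remains to control the variation by the norm. The identity `2(φ(x+ε) - φ(x)) = (φ(x+2ε) - φ(x)) -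
(second difference)` is iterated over the scales `2^k ε`. The remainder vanishes because means of a
`BMO` function grow only logarithmically, and averaging over `ε` bounds the difference quotients in
`L¹` by the Besov seminorm (`exists_lintegral_difference_quotient_le`). Steklov means of `φ`
therefore have bounded variation uniformly along some `ε → 0`, and Fatou's lemma gives the factor
`e^{2V} + 12V` for `φ` itself.

For large `V`, `h` is a composition of `2^n` diffeomorphisms of variation `V / 2^n`, to which the
small case applies (`exists_halves`, `besovSharpNorm_comp_le`). The lower bound on the norm comes
from the upper bound for the inverse. -/

/-! ### Diffeomorphisms with logarithmic derivative of bounded variation. -/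

/-- `h` is a `C¹` diffeomorphism with `log h' = u`, and the variation of `u` is controlled by the
measure `μ`. -/
structure HasLogDeriv (h : ℝ ≃ₜ ℝ) (u : ℝ → ℝ) (μ : Measure ℝ) : Prop where
  hasDerivAt : ∀ x, HasDerivAt h (Real.exp (u x)) x
  continuous : Continuous u
  enorm_sub_le : ∀ a b, a ≤ b → ‖u b - u a‖ₑ ≤ μ (Ioc a b)

namespace HasLogDeriv

variable {h : ℝ ≃ₜ ℝ} {u : ℝ → ℝ} {μ : Measure ℝ} {V : ℝ}

theorem strictMono (H : HasLogDeriv h u μ) : StrictMono h :=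
  strictMono_of_deriv_pos fun x => by rw [(H.hasDerivAt x).deriv]; exact Real.exp_pos _

theorem strictMono_symm (H : HasLogDeriv h u μ) : StrictMono h.symm := fun a b hab => by
  rw [← H.strictMono.lt_iff_lt]; simpa using hab

theorem abs_sub_le (H : HasLogDeriv h u μ) (hV : 0 ≤ V) (hμ : μ univ ≤ ENNReal.ofReal V)
    (x y : ℝ) : |u x - u y| ≤ V := by
  wlog hxy : y ≤ x generalizing x y
  · rw [abs_sub_comm]; exact this y x (le_of_not_ge hxy)
  have := (H.enorm_sub_le y x hxy).trans ((measure_mono (subset_univ _)).trans hμ)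
  rwa [Real.enorm_eq_ofReal_abs, ENNReal.ofReal_le_ofReal_iff hV] at this

/-- The oscillation of `u` is at most `V`, so `m = exp (inf u)` works. The size of `m` is not
controlled, but it cancels in every later estimate. -/
theorem exists_bounds (H : HasLogDeriv h u μ) (hV : 0 ≤ V) (hμ : μ univ ≤ ENNReal.ofReal V) :
    ∃ m : ℝ, 0 < m ∧ ∀ x, m ≤ Real.exp (u x) ∧ Real.exp (u x) ≤ Real.exp V * m := by
  have hb : BddBelow (range u) := ⟨u 0 - V, by
    rintro _ ⟨x, rfl⟩
    have := abs_le.1 (H.abs_sub_le hV hμ x 0)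
    linarith⟩
  refine ⟨Real.exp (sInf (range u)), Real.exp_pos _, fun x => ⟨?_, ?_⟩⟩
  · exact Real.exp_le_exp.2 (csInf_le hb ⟨x, rfl⟩)
  · rw [← Real.exp_add, Real.exp_le_exp]
    have : u x - V ≤ sInf (range u) := le_csInf (range_nonempty u) (by
      rintro _ ⟨y, rfl⟩
      have := abs_le.1 (H.abs_sub_le hV hμ x y)
      linarith)
    linarith

theorem setLIntegral_image (H : HasLogDeriv h u μ) {s : Set ℝ} (hs : MeasurableSet s)
    (f : ℝ → ℝ≥0∞) :
    ∫⁻ y in h '' s, f y = ∫⁻ x in s, ENNReal.ofReal (Real.exp (u x)) * f (h x) := by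
  rw [lintegral_image_eq_lintegral_abs_deriv_mul hs
    (fun x _ => (H.hasDerivAt x).hasDerivWithinAt) h.injective.injOn]
  simp only [abs_of_pos (Real.exp_pos _)]

theorem setLIntegral_comp_le (H : HasLogDeriv h u μ) {s : Set ℝ} (hs : MeasurableSet s)
    {m : ℝ} (hm : 0 < m) (hu : ∀ x, m ≤ Real.exp (u x)) (f : ℝ → ℝ≥0∞) :
    ∫⁻ x in s, f (h x) ≤ ENNReal.ofReal m⁻¹ * ∫⁻ y in h '' s, f y := by
  rw [H.setLIntegral_image hs, ← lintegral_const_mul' _ _ ENNReal.ofReal_ne_top]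
  refine lintegral_mono fun x => ?_
  rw [← mul_assoc, ← ENNReal.ofReal_mul (inv_nonneg.2 hm.le)]
  refine le_mul_of_one_le_left' ?_
  rw [ENNReal.one_le_ofReal, ← div_eq_inv_mul, one_le_div hm]
  exact hu x

theorem lintegral_comp_le (H : HasLogDeriv h u μ)
    {m : ℝ} (hm : 0 < m) (hu : ∀ x, m ≤ Real.exp (u x)) (f : ℝ → ℝ≥0∞) :
    ∫⁻ x, f (h x) ≤ ENNReal.ofReal m⁻¹ * ∫⁻ y, f y := by
  have := H.setLIntegral_comp_le MeasurableSet.univ hm hu f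
  rwa [image_univ, h.surjective.range_eq, setLIntegral_univ, setLIntegral_univ] at this

theorem mul_le_sub (H : HasLogDeriv h u μ) {m : ℝ} (hu : ∀ x, m ≤ Real.exp (u x)) {x y : ℝ}
    (hxy : x ≤ y) : m * (y - x) ≤ h y - h x := by
  have : Monotone fun z => h z - m * z := by
    apply monotone_of_deriv_nonneg (fun z => ((H.hasDerivAt z).sub
      ((hasDerivAt_id z).const_mul m)).differentiableAt)
    intro z
    rw [((H.hasDerivAt z).sub ((hasDerivAt_id z).const_mul m)).deriv]
    linarith [hu z]
  linarith [this hxy]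

theorem sub_le_mul (H : HasLogDeriv h u μ) {M : ℝ} (hu : ∀ x, Real.exp (u x) ≤ M) {x y : ℝ}
    (hxy : x ≤ y) : h y - h x ≤ M * (y - x) := by
  have : Monotone fun z => M * z - h z := by
    apply monotone_of_deriv_nonneg (fun z => (((hasDerivAt_id z).const_mul M).sub
      (H.hasDerivAt z)).differentiableAt)
    intro z
    rw [(((hasDerivAt_id z).const_mul M).sub (H.hasDerivAt z)).deriv]
    linarith [hu z]
  linarith [this hxy]

theorem hasDerivAt_symm (H : HasLogDeriv h u μ) (y : ℝ) :
    HasDerivAt h.symm (Real.exp (u (h.symm y)))⁻¹ y :=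
  (H.hasDerivAt (h.symm y)).of_local_left_inverse h.symm.continuous.continuousAt
    (Real.exp_ne_zero _) (Eventually.of_forall fun z => h.apply_symm_apply z)

theorem map_Ioc (H : HasLogDeriv h u μ) (ν : Measure ℝ) (a b : ℝ) :
    ν.map h (Ioc a b) = ν (Ioc (h.symm a) (h.symm b)) := by
  rw [Measure.map_apply h.measurable measurableSet_Ioc]
  congr 1
  ext x
  simp only [mem_preimage, mem_Ioc]
  rw [← H.strictMono_symm.lt_iff_lt, ← H.strictMono_symm.le_iff_le, h.symm_apply_apply]

/-- The pushforward has the same total mass, so every bound in terms of `V` also applies to the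
inverse. -/
theorem symm (H : HasLogDeriv h u μ) :
    HasLogDeriv h.symm (fun y => -u (h.symm y)) (μ.map h) where
  hasDerivAt y := by rw [Real.exp_neg]; exact H.hasDerivAt_symm y
  continuous := (H.continuous.comp h.symm.continuous).neg
  enorm_sub_le a b hab := by
    rw [H.map_Ioc, show -u (h.symm b) - -u (h.symm a) = -(u (h.symm b) - u (h.symm a)) by ring,
      enorm_neg]
    exact H.enorm_sub_le _ _ (H.strictMono_symm.monotone hab)

theorem map_univ (ν : Measure ℝ) (k : ℝ ≃ₜ ℝ) : ν.map k univ = ν univ := by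
  rw [Measure.map_apply k.measurable MeasurableSet.univ, preimage_univ]

end HasLogDeriv

/-! ### Splitting a diffeomorphism into two of half the variation. -/

/-- A continuous function bounded below has an exponential which integrates to a homeomorphism. -/
theorem exists_homeomorph_hasDerivAt_exp {u : ℝ → ℝ} (hu : Continuous u) {c : ℝ}
    (hc : ∀ x, c ≤ u x) : ∃ k : ℝ ≃ₜ ℝ, ∀ x, HasDerivAt k (Real.exp (u x)) x := by
  set k : ℝ → ℝ := fun x => ∫ t in (0 : ℝ)..x, Real.exp (u t) with hk
  have cont : Continuous fun x => Real.exp (u x) := by fun_prop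
  have hd : ∀ x, HasDerivAt k (Real.exp (u x)) x := fun x =>
    intervalIntegral.integral_hasDerivAt_right (cont.intervalIntegrable _ _)
      cont.aestronglyMeasurable.stronglyMeasurableAtFilter cont.continuousAt
  have hmono : StrictMono k := strictMono_of_deriv_pos fun x => by
    rw [(hd x).deriv]; exact Real.exp_pos _
  have hm : Monotone fun z => k z - Real.exp c * z := by
    apply monotone_of_deriv_nonneg (fun z => ((hd z).sub
      ((hasDerivAt_id z).const_mul (Real.exp c))).differentiableAt)
    intro z
    rw [((hd z).sub ((hasDerivAt_id z).const_mul (Real.exp c))).deriv]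
    linarith [Real.exp_le_exp.2 (hc z)]
  have k0 : k 0 = 0 := by simp [hk]
  -- The slope is at least `exp c`, so `k` lies beyond a linear function at both ends; this gives
  -- surjectivity.
  have ctop : Tendsto k atTop atTop := by
    refine tendsto_atTop_mono' _ ?_ ((tendsto_const_mul_atTop_of_pos (Real.exp_pos c)).2 tendsto_id)
    filter_upwards [eventually_ge_atTop 0] with x hx
    have := hm hx
    simp only [k0, id] at this ⊢
    linarith
  have cbot : Tendsto k atBot atBot := by
    refine tendsto_atBot_mono' _ ?_ ((tendsto_const_mul_atBot_of_pos (Real.exp_pos c)).2 tendsto_id)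
    filter_upwards [eventually_le_atBot 0] with x hx
    have := hm hx
    simp only [k0, id] at this ⊢
    linarith
  have kc : Continuous k := continuous_iff_continuousAt.2 fun x => (hd x).continuousAt
  exact ⟨(hmono.orderIsoOfSurjective k (kc.surjective ctop cbot)).toHomeomorph, hd⟩

/-- A diffeomorphism splits into two diffeomorphisms whose logarithmic derivatives have half
the variation. -/
theorem HasLogDeriv.exists_halves {h : ℝ ≃ₜ ℝ} {u : ℝ → ℝ} {μ : Measure ℝ} {V : ℝ}
    (H : HasLogDeriv h u μ) (hV : 0 ≤ V) (hμ : μ univ ≤ ENNReal.ofReal (2 * V)) :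
    ∃ (k l : ℝ ≃ₜ ℝ) (v w : ℝ → ℝ) (κ ξ : Measure ℝ), HasLogDeriv k v κ ∧ HasLogDeriv l w ξ ∧
      κ univ ≤ ENNReal.ofReal V ∧ ξ univ ≤ ENNReal.ofReal V ∧ ∀ x, h x = l (k x) := by
  have hc : ∀ x, (u 0 - 2 * V) / 2 ≤ u x / 2 := fun x => by
    have := abs_le.1 (H.abs_sub_le (by positivity) hμ x 0)
    linarith
  obtain ⟨k, hk⟩ := exists_homeomorph_hasDerivAt_exp (H.continuous.div_const 2) hc
  have half : ((2 : ℝ≥0∞)⁻¹ • μ) univ ≤ ENNReal.ofReal V := by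
    rw [Measure.smul_apply, smul_eq_mul]
    refine (mul_le_mul_right hμ _).trans (le_of_eq ?_)
    rw [ENNReal.ofReal_mul zero_le_two, ← mul_assoc, ENNReal.ofReal_ofNat,
      ENNReal.inv_mul_cancel (by simp) (by simp), one_mul]
  have K : HasLogDeriv k (fun x => u x / 2) ((2 : ℝ≥0∞)⁻¹ • μ) := by
    refine ⟨hk, H.continuous.div_const 2, fun a b hab => ?_⟩
    rw [← sub_div, div_eq_inv_mul, enorm_mul, Measure.smul_apply, smul_eq_mul]
    refine mul_le_mul' (le_of_eq ?_) (H.enorm_sub_le a b hab)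
    rw [Real.enorm_eq_ofReal (by positivity), ENNReal.ofReal_inv_of_pos (by positivity),
      ENNReal.ofReal_ofNat]
  -- With `k' = exp (u/2)`, the second factor `h ∘ k⁻¹` has derivative `exp (u - u/2)` evaluated at
  -- `k⁻¹ y`, so both factors carry half of `u`.
  refine ⟨k, k.symm.trans h, _, fun y => u (k.symm y) / 2, _, ((2 : ℝ≥0∞)⁻¹ • μ).map k, K,
    ⟨fun y => ?_, by have := H.continuous; fun_prop, fun a b hab => ?_⟩, half, ?_, fun x => ?_⟩
  · refine ((H.hasDerivAt (k.symm y)).comp y (K.hasDerivAt_symm y)).congr_deriv ?_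
    rw [← Real.exp_neg, ← Real.exp_add]
    congr 1
    ring
  · rw [K.map_Ioc]
    exact K.enorm_sub_le _ _ (K.strictMono_symm.monotone hab)
  · rwa [HasLogDeriv.map_univ]
  · simp

/-! ### Change of variables and the `BMO` estimate. -/

namespace HasLogDeriv

variable {h : ℝ ≃ₜ ℝ} {u : ℝ → ℝ} {μ : Measure ℝ} {V : ℝ}

theorem quasiMeasurePreserving (H : HasLogDeriv h u μ) :
    Measure.QuasiMeasurePreserving h volume volume := by
  refine ⟨h.measurable, Measure.AbsolutelyContinuous.mk fun s hs h0 => ?_⟩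
  rw [Measure.map_apply h.measurable hs, ← h.image_symm]
  exact addHaar_image_eq_zero_of_differentiableOn_of_addHaar_eq_zero volume
    (fun y _ => (H.hasDerivAt_symm y).differentiableAt.differentiableWithinAt) h0

theorem integrableOn_smul_comp (H : HasLogDeriv h u μ) {φ : ℝ → ℂ} {s : Set ℝ}
    (hs : MeasurableSet s) (hφ : IntegrableOn φ (h '' s)) :
    IntegrableOn (fun x => Real.exp (u x) • φ (h x)) s := by
  have := (integrableOn_image_iff_integrableOn_abs_deriv_smul hs
    (fun x _ => (H.hasDerivAt x).hasDerivWithinAt) h.injective.injOn φ).1 hφ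
  simpa only [abs_of_pos (Real.exp_pos _)] using this

theorem integral_smul_comp (H : HasLogDeriv h u μ) (φ : ℝ → ℂ) {s : Set ℝ}
    (hs : MeasurableSet s) :
    ∫ x in s, Real.exp (u x) • φ (h x) = ∫ y in h '' s, φ y := by
  rw [integral_image_eq_integral_abs_deriv_smul hs
    (fun x _ => (H.hasDerivAt x).hasDerivWithinAt) h.injective.injOn φ]
  simp only [abs_of_pos (Real.exp_pos _)]

theorem locallyIntegrable_comp (H : HasLogDeriv h u μ) {φ : ℝ → ℂ} (hφ : LocallyIntegrable φ) :
    LocallyIntegrable (φ ∘ h) := by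
  rw [locallyIntegrable_iff]
  intro K hK
  have h1 := H.integrableOn_smul_comp hK.measurableSet
    (hφ.integrableOn_isCompact (hK.image h.continuous))
  -- Multiplying by the continuous function `1 / h'` removes the Jacobian and keeps integrability on
  -- compact sets.
  have hc : Continuous fun x => Real.exp (-u x) := by have := H.continuous; fun_prop
  have h2 := h1.continuousOn_smul hc.continuousOn hK
  refine h2.congr_fun (fun x _ => ?_) hK.measurableSet
  simp only [smul_smul, ← Real.exp_add, Function.comp_apply]
  simp

theorem image_Icc (H : HasLogDeriv h u μ) (a b : ℝ) : h '' Icc a b = Icc (h a) (h b) := by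
  ext y
  constructor
  · rintro ⟨x, hx, rfl⟩
    exact ⟨H.strictMono.monotone hx.1, H.strictMono.monotone hx.2⟩
  · intro hy
    refine ⟨h.symm y, ⟨?_, ?_⟩, h.apply_symm_apply y⟩
    · rw [← H.strictMono.le_iff_le]; simpa using hy.1
    · rw [← H.strictMono.le_iff_le]; simpa using hy.2

end HasLogDeriv

theorem lintegral_oscillation_le_bmoNorm (φ : ℝ → ℂ) {a b : ℝ} (hab : a < b) :
    ∫⁻ x in Icc a b, ‖φ x - ⨍ y in Icc a b, φ y‖ₑ ≤ ENNReal.ofReal (b - a) * bmoNorm φ := by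
  rw [mul_comm, ← ENNReal.div_le_iff (by simpa using hab) ENNReal.ofReal_ne_top]
  exact le_iSup_of_le a (le_iSup_of_le b (le_iSup_of_le hab le_rfl))

/-- One factor `e^V` comes from the change of variables with the constant `c = φ_{h(I)}`, the other
from replacing `c` by the mean `c'` of `φ ∘ h`. The usual bound for changing the constant loses a
factor 2, which would not tend to 1 with `V`; the cancellation in `zero` avoids this. -/
theorem HasLogDeriv.bmoNorm_comp_le {h : ℝ ≃ₜ ℝ} {u : ℝ → ℝ} {μ : Measure ℝ} {V : ℝ}
    (H : HasLogDeriv h u μ) (hV : 0 ≤ V) (hμ : μ univ ≤ ENNReal.ofReal V) {φ : ℝ → ℂ}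
    (hφ : LocallyIntegrable φ) :
    bmoNorm (φ ∘ h) ≤ ENNReal.ofReal (Real.exp (2 * V)) * bmoNorm φ := by
  obtain ⟨m, hm, hu⟩ := H.exists_bounds hV hμ
  refine iSup_le fun a => iSup_le fun b => iSup_le fun hab => ?_
  have hba : 0 < b - a := sub_pos.2 hab
  have hJ : 0 < h b - h a := sub_pos.2 (H.strictMono hab)
  have lo := H.mul_le_sub (fun x => (hu x).1) hab.le
  have hi := H.sub_le_mul (fun x => (hu x).2) hab.le
  have iJ : IntegrableOn φ (Icc (h a) (h b)) := hφ.integrableOn_isCompact isCompact_Icc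
  have iI : IntegrableOn (φ ∘ h) (Icc a b) :=
    (H.locallyIntegrable_comp hφ).integrableOn_isCompact isCompact_Icc
  set c : ℂ := ⨍ y in Icc (h a) (h b), φ y with hc
  set c' : ℂ := ⨍ y in Icc a b, (φ ∘ h) y with hc'
  set A : ℝ≥0∞ := ∫⁻ x in Icc a b, ‖φ (h x) - c‖ₑ with hA
  have A_le : A ≤ ENNReal.ofReal (Real.exp V * (b - a)) * bmoNorm φ := by
    refine (H.setLIntegral_comp_le measurableSet_Icc hm (fun x => (hu x).1)
      (fun y => ‖φ y - c‖ₑ)).trans ?_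
    rw [H.image_Icc]
    refine (mul_le_mul_right (lintegral_oscillation_le_bmoNorm φ (sub_pos.1 hJ)) _).trans ?_
    rw [← mul_assoc, ← ENNReal.ofReal_mul (inv_nonneg.2 hm.le)]
    refine mul_le_mul_left (ENNReal.ofReal_le_ofReal ?_) _
    rw [inv_mul_le_iff₀ hm]
    linarith
  have vI : volume.real (Icc a b) = b - a := by simp [hab.le]
  have vJ : volume.real (Icc (h a) (h b)) = h b - h a := by
    simp [(H.strictMono hab).le]
  have cJ : IntegrableOn (fun _ => c) (Icc (h a) (h b)) := by simp
  have cI : IntegrableOn (fun _ => c) (Icc a b) := by simp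
  -- The weight `h'` turns the integral over `I` into one over `h(I)`, where `φ - c` has mean zero.
  have zero : ∫ x in Icc a b, Real.exp (u x) • (φ (h x) - c) = 0 := by
    rw [H.integral_smul_comp (fun y => φ y - c) measurableSet_Icc, H.image_Icc,
      integral_sub iJ cJ, setIntegral_const, vJ, hc, setAverage_eq, vJ, smul_smul,
      mul_inv_cancel₀ hJ.ne', one_smul, sub_self]
  have iE : IntegrableOn (fun x => Real.exp (u x) • (φ (h x) - c)) (Icc a b) := by
    refine H.integrableOn_smul_comp (φ := fun y => φ y - c) measurableSet_Icc ?_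
    rw [H.image_Icc]
    exact iJ.sub cJ
  -- Here `lam = |I| / |h(I)|`, so `lam * h'` has mean 1 over `I` and is uniformly close to 1.
  set lam : ℝ := (b - a) / (h b - h a) with hlam
  have diff : (b - a) • (c' - c) =
      ∫ x in Icc a b, (1 - lam * Real.exp (u x)) • (φ (h x) - c) := by
    have h1 : ∫ x in Icc a b, (φ (h x) - c) = (b - a) • (c' - c) := by
      rw [integral_sub (f := fun x => φ (h x)) iI cI, setIntegral_const, vI, smul_sub]
      congr 1
      rw [hc', setAverage_eq, vI, smul_smul, mul_inv_cancel₀ hba.ne', one_smul]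
      rfl
    rw [← h1]
    calc ∫ x in Icc a b, (φ (h x) - c)
        = (∫ x in Icc a b, (φ (h x) - c)) -
            lam • ∫ x in Icc a b, Real.exp (u x) • (φ (h x) - c) := by rw [zero, smul_zero, sub_zero]
      _ = ∫ x in Icc a b, ((φ (h x) - c) - lam • (Real.exp (u x) • (φ (h x) - c))) := by
          rw [← integral_smul]
          exact (integral_sub (iI.sub cI) (iE.smul lam)).symm
      _ = _ := by
          congr 1
          ext x
          rw [smul_smul, sub_smul, one_smul]
  have eV : 1 ≤ Real.exp V := Real.one_le_exp hV
  have bound : ∀ x, |1 - lam * Real.exp (u x)| ≤ Real.exp V - 1 := fun x => by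
    have up : lam * Real.exp (u x) ≤ Real.exp V := by
      rw [hlam, div_mul_eq_mul_div, div_le_iff₀ hJ]
      calc (b - a) * Real.exp (u x) ≤ (b - a) * (Real.exp V * m) := by
            gcongr; exact (hu x).2
        _ = Real.exp V * (m * (b - a)) := by ring
        _ ≤ _ := by gcongr
    -- The natural lower bound is `e^{-V}`, which is at least `2 - e^V`; the weaker form matches the
    -- upper bound.
    have dn : 2 - Real.exp V ≤ lam * Real.exp (u x) := by
      rw [hlam, div_mul_eq_mul_div, le_div_iff₀ hJ]
      rcases le_total (2 - Real.exp V) 0 with hn | hp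
      · nlinarith [Real.exp_pos (u x)]
      · calc (2 - Real.exp V) * (h b - h a) ≤ (2 - Real.exp V) * (Real.exp V * m * (b - a)) := by
              gcongr
          _ = ((2 - Real.exp V) * Real.exp V) * (m * (b - a)) := by ring
          _ ≤ 1 * (m * (b - a)) := by
              gcongr
              nlinarith [sq_nonneg (Real.exp V - 1)]
          _ ≤ (b - a) * Real.exp (u x) := by
              rw [one_mul, mul_comm]; gcongr; exact (hu x).1
    rw [abs_le]; constructor <;> linarith
  have mean : ENNReal.ofReal (b - a) * ‖c' - c‖ₑ ≤ ENNReal.ofReal (Real.exp V - 1) * A := by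
    rw [← Real.enorm_eq_ofReal hba.le, ← enorm_smul, diff, hA,
      ← lintegral_const_mul' _ _ ENNReal.ofReal_ne_top]
    refine (enorm_integral_le_lintegral_enorm _).trans (lintegral_mono fun x => ?_)
    rw [enorm_smul]
    gcongr
    rw [Real.enorm_eq_ofReal_abs]
    exact ENNReal.ofReal_le_ofReal (bound x)
  rw [ENNReal.div_le_iff (by simpa using hab) ENNReal.ofReal_ne_top]
  calc ∫⁻ x in Icc a b, ‖(φ ∘ h) x - c'‖ₑ
      ≤ ∫⁻ x in Icc a b, (‖φ (h x) - c‖ₑ + ‖c' - c‖ₑ) := by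
        refine lintegral_mono fun x => ?_
        rw [enorm_sub_rev c' c]
        refine le_trans (le_of_eq ?_) (enorm_add_le _ _)
        simp
    _ = A + ENNReal.ofReal (b - a) * ‖c' - c‖ₑ := by
        rw [lintegral_add_right _ measurable_const, setLIntegral_const, Real.volume_Icc, mul_comm]
    _ ≤ A + ENNReal.ofReal (Real.exp V - 1) * A := by gcongr
    _ = ENNReal.ofReal (Real.exp V) * A := by
        rw [← one_add_mul, ← ENNReal.ofReal_one,
          ← ENNReal.ofReal_add zero_le_one (by linarith)]
        congr 2
        ring
    _ ≤ ENNReal.ofReal (Real.exp V) * (ENNReal.ofReal (Real.exp V * (b - a)) * bmoNorm φ) := by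
        gcongr
    _ = _ := by
        rw [← mul_assoc, ← ENNReal.ofReal_mul (Real.exp_pos V).le, two_mul, Real.exp_add,
          mul_right_comm, ← ENNReal.ofReal_mul (by positivity), mul_assoc]

/-! ### One-sided form of the Besov seminorm, and second differences of `h`. -/

/-- The `L¹` norm of the second difference of `φ` with step `t`. -/
noncomputable def secondDiffNorm (φ : ℝ → ℂ) (t : ℝ) : ℝ≥0∞ :=
  ∫⁻ x : ℝ, ‖φ (x + 2 * t) - 2 * φ (x + t) + φ x‖ₑ

theorem inv_ofReal_sq_ne_top {t : ℝ} (ht : 0 < t) : (ENNReal.ofReal (t ^ 2))⁻¹ ≠ ⊤ := by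
  simp [ht.ne']

theorem secondDiffNorm_neg (φ : ℝ → ℂ) (t : ℝ) : secondDiffNorm φ (-t) = secondDiffNorm φ t := by
  unfold secondDiffNorm
  rw [← lintegral_add_right_eq_self _ (2 * t)]
  refine lintegral_congr fun x => ?_
  rw [show x + 2 * t + 2 * -t = x by ring, show x + 2 * t + -t = x + t by ring]
  congr 1
  ring

theorem besovSharpNorm_eq_setLIntegral (φ : ℝ → ℂ) :
    besovSharpNorm φ =
      2 * ∫⁻ t in Ioi (0 : ℝ), secondDiffNorm φ t / ENNReal.ofReal (t ^ 2) := by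
  have key : ∀ t : ℝ, t ≠ 0 →
      ∫⁻ x : ℝ, ‖φ (x + 2 * t) - 2 * φ (x + t) + φ x‖ₑ / ENNReal.ofReal (t ^ 2) =
      secondDiffNorm φ t / ENNReal.ofReal (t ^ 2) := fun t ht => by
    simp only [div_eq_mul_inv]
    exact lintegral_mul_const' _ _ (by simp [ht])
  have h0 : besovSharpNorm φ = ∫⁻ t : ℝ, secondDiffNorm φ t / ENNReal.ofReal (t ^ 2) := by
    refine lintegral_congr_ae ?_
    filter_upwards [compl_mem_ae_iff.2 (measure_singleton (0 : ℝ))] with t ht using key t ht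
  rw [h0, ← lintegral_add_compl _ (measurableSet_Ioi (a := (0 : ℝ))), two_mul, compl_Ioi,
    setLIntegral_congr Iio_ae_eq_Iic.symm]
  congr 1
  have := (Measure.measurePreserving_neg (volume : Measure ℝ)).setLIntegral_comp_preimage_emb
    (MeasurableEquiv.neg ℝ).measurableEmbedding
    (fun t => secondDiffNorm φ t / ENNReal.ofReal (t ^ 2)) (Iio 0)
  rw [← this]
  have hpre : (Neg.neg ⁻¹' Iio 0 : Set ℝ) = Ioi 0 := by ext; simp
  rw [hpre]
  simp only [secondDiffNorm_neg, neg_sq]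

/-- The integral is scale invariant. It is what turns a point mass of `μ` at distance `s` into a
bounded contribution to the integral in `dt/t²`. -/
theorem lintegral_Ici_div_sq {s : ℝ} (hs : 0 < s) :
    ∫⁻ t in Ici (s / 2), ENNReal.ofReal s / ENNReal.ofReal (t ^ 2) = 2 := by
  have hs2 : 0 < s / 2 := half_pos hs
  rw [setLIntegral_congr Ioi_ae_eq_Ici.symm]
  have e : ∀ t ∈ Ioi (s / 2), ENNReal.ofReal s / ENNReal.ofReal (t ^ 2) =
      ENNReal.ofReal s * ENNReal.ofReal (t ^ (-2 : ℝ)) := fun t ht => by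
    have ht0 : 0 < t := hs2.trans ht
    rw [div_eq_mul_inv, ← ENNReal.ofReal_inv_of_pos (by positivity), Real.rpow_neg ht0.le,
      Real.rpow_two]
  rw [setLIntegral_congr_fun measurableSet_Ioi e,
    lintegral_const_mul' _ _ ENNReal.ofReal_ne_top,
    ← ofReal_integral_eq_lintegral_ofReal (integrableOn_Ioi_rpow_of_lt (by norm_num) hs2),
    integral_Ioi_rpow_of_lt (by norm_num) hs2, ← ENNReal.ofReal_mul hs.le]
  · have : s * (-(s / 2) ^ ((-2 : ℝ) + 1) / (-2 + 1)) = 2 := by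
      norm_num
      rw [Real.rpow_neg_one]
      field_simp
    rw [this, ENNReal.ofReal_ofNat]
  · filter_upwards [ae_restrict_mem measurableSet_Ioi] with t ht
    exact (Real.rpow_pos_of_pos (hs2.trans ht) _).le

theorem abs_exp_sub_exp_le {a b M : ℝ} (ha : Real.exp a ≤ M) (hb : Real.exp b ≤ M) :
    |Real.exp a - Real.exp b| ≤ M * |a - b| := by
  wlog hab : b ≤ a generalizing a b
  · rw [abs_sub_comm, abs_sub_comm a]; exact this hb ha (le_of_not_ge hab)
  rw [abs_of_nonneg (sub_nonneg.2 (Real.exp_le_exp.2 hab)), abs_of_nonneg (sub_nonneg.2 hab)]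
  have h1 : Real.exp b = Real.exp a * Real.exp (b - a) := by rw [← Real.exp_add]; congr 1; ring
  have h2 := Real.add_one_le_exp (b - a)
  nlinarith [Real.exp_pos a, mul_le_mul_of_nonneg_right ha (sub_nonneg.2 hab)]

namespace HasLogDeriv

variable {h : ℝ ≃ₜ ℝ} {u : ℝ → ℝ} {μ : Measure ℝ}

/-- The second difference is the integral over `0 < r ≤ t` of `h'(p+t+r) - h'(p+r)`, and `exp` has
Lipschitz constant `M` on the range of `u`. -/
theorem enorm_secondDiff_le (H : HasLogDeriv h u μ) {M : ℝ} (hM : ∀ x, Real.exp (u x) ≤ M)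
    (p : ℝ) {t : ℝ} (ht : 0 < t) :
    ‖h (p + 2 * t) - 2 * h (p + t) + h p‖ₑ ≤
      ENNReal.ofReal M * ∫⁻ r in Ioc 0 t, μ (Ioc (p + r) (p + t + r)) := by
  have cu := H.continuous
  have ftc : ∀ c : ℝ, ∫ r in (0 : ℝ)..t, Real.exp (u (c + r)) = h (c + t) - h c := fun c => by
    have hd : ∀ r ∈ uIcc 0 t, HasDerivAt (fun r => h (c + r)) (Real.exp (u (c + r))) r :=
      fun r _ => (H.hasDerivAt (c + r)).comp_const_add c r
    have hc : Continuous fun r => Real.exp (u (c + r)) := by fun_prop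
    rw [intervalIntegral.integral_eq_sub_of_hasDerivAt hd (hc.intervalIntegrable _ _), add_zero]
  have c1 : Continuous fun r => Real.exp (u (p + t + r)) := by fun_prop
  have c2 : Continuous fun r => Real.exp (u (p + r)) := by fun_prop
  have e : h (p + 2 * t) - 2 * h (p + t) + h p =
      ∫ r in Ioc 0 t, (Real.exp (u (p + t + r)) - Real.exp (u (p + r))) := by
    rw [← intervalIntegral.integral_of_le ht.le, intervalIntegral.integral_sub
      (c1.intervalIntegrable _ _) (c2.intervalIntegrable _ _), ftc, ftc,
      show p + t + t = p + 2 * t by ring]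
    ring
  rw [e, ← lintegral_const_mul' _ _ ENNReal.ofReal_ne_top]
  refine (enorm_integral_le_lintegral_enorm _).trans (lintegral_mono fun r => ?_)
  refine le_trans ?_ (mul_le_mul_right (H.enorm_sub_le (p + r) (p + t + r) (by linarith)) _)
  rw [Real.enorm_eq_ofReal_abs, Real.enorm_eq_ofReal_abs,
    ← ENNReal.ofReal_mul ((Real.exp_pos _).le.trans (hM 0))]
  exact ENNReal.ofReal_le_ofReal (abs_exp_sub_exp_le (hM _) (hM _))

end HasLogDeriv

/-- Fubini: a point `q` is counted for `r` in `[q-p-t, q-p) ∩ (0, t]`, a set of length at most `q -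
p` that is empty unless `0 < q - p ≤ 2t`. -/
theorem lintegral_measure_Ioc_le (μ : Measure ℝ) [SFinite μ] (p t : ℝ) :
    ∫⁻ r in Ioc 0 t, μ (Ioc (p + r) (p + t + r)) ≤
      ∫⁻ q, {q | 0 < q - p ∧ q - p ≤ 2 * t}.indicator (fun q => ENNReal.ofReal (q - p)) q ∂μ := by
  have e : ∀ r, μ (Ioc (p + r) (p + t + r)) =
      ∫⁻ q, {x : ℝ × ℝ | p + x.1 < x.2 ∧ x.2 ≤ p + t + x.1}.indicator 1 (r, q) ∂μ := fun r => by
    rw [← lintegral_indicator_one measurableSet_Ioc]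
    rfl
  have hS : MeasurableSet {x : ℝ × ℝ | p + x.1 < x.2 ∧ x.2 ≤ p + t + x.1} := by
    measurability
  simp only [e]
  rw [lintegral_lintegral_swap (f := fun r q => indicator _ _ (r, q))
    (measurable_one.indicator hS).aemeasurable]
  refine lintegral_mono fun q => ?_
  have e2 : ∀ r, {x : ℝ × ℝ | p + x.1 < x.2 ∧ x.2 ≤ p + t + x.1}.indicator
      (1 : ℝ × ℝ → ℝ≥0∞) (r, q) = (Ico (q - p - t) (q - p)).indicator 1 r := fun r => by
    simp only [indicator, mem_ofPred_eq, mem_Ico, Pi.one_apply]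
    congr 1
    apply propext
    constructor <;> rintro ⟨h1, h2⟩ <;> constructor <;> linarith
  simp only [e2]
  rw [lintegral_indicator_one measurableSet_Ico, Measure.restrict_apply measurableSet_Ico]
  by_cases hq : 0 < q - p ∧ q - p ≤ 2 * t
  · rw [indicator_of_mem (by exact hq)]
    calc volume (Ico (q - p - t) (q - p) ∩ Ioc 0 t) ≤ volume (Icc 0 (q - p)) :=
          measure_mono fun x hx => ⟨hx.2.1.le, hx.1.2.le⟩
      _ = _ := by simp
  · rw [indicator_of_notMem (by exact hq), nonpos_iff_eq_zero]
    convert measure_empty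
    · rw [eq_empty_iff_forall_notMem]
      rintro x ⟨⟨h1, h2⟩, h3, h4⟩
      exact hq ⟨by linarith, by linarith⟩
    · infer_instance

namespace HasLogDeriv

variable {h : ℝ ≃ₜ ℝ} {u : ℝ → ℝ} {μ : Measure ℝ}

/-- After exchanging the integrals, each `q > p` contributes at most the integral of `(q-p)/t²` over
`t ≥ (q-p)/2`, which is 2. The bound is uniform in the base point `p`. -/
theorem lintegral_secondDiff_le (H : HasLogDeriv h u μ) [SFinite μ] {M : ℝ}
    (hM : ∀ x, Real.exp (u x) ≤ M) (p : ℝ) :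
    ∫⁻ t in Ioi (0 : ℝ), ‖h (p + 2 * t) - 2 * h (p + t) + h p‖ₑ / ENNReal.ofReal (t ^ 2) ≤
      ENNReal.ofReal M * (2 * μ univ) := by
  set S : Set (ℝ × ℝ) := {x | 0 < x.2 - p ∧ x.2 - p ≤ 2 * x.1} with hSdef
  have hS : MeasurableSet S := by measurability
  set f : ℝ × ℝ → ℝ≥0∞ :=
    S.indicator (fun x => ENNReal.ofReal (x.2 - p) / ENNReal.ofReal (x.1 ^ 2)) with hf
  have mf : Measurable f := Measurable.indicator (by fun_prop) hS
  calc ∫⁻ t in Ioi (0 : ℝ), ‖h (p + 2 * t) - 2 * h (p + t) + h p‖ₑ / ENNReal.ofReal (t ^ 2)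
      ≤ ∫⁻ t in Ioi (0 : ℝ), ENNReal.ofReal M * ∫⁻ q, f (t, q) ∂μ := by
        refine setLIntegral_mono' measurableSet_Ioi fun t ht => ?_
        refine (ENNReal.div_le_div_right ((H.enorm_secondDiff_le hM p ht).trans
          (mul_le_mul_right (lintegral_measure_Ioc_le μ p t) _)) _).trans (le_of_eq ?_)
        rw [mul_div_assoc, div_eq_mul_inv, ← lintegral_mul_const' _ _ (inv_ofReal_sq_ne_top ht)]
        congr 2
        ext q
        simp only [hf, indicator, hSdef, mem_ofPred_eq, ite_mul, zero_mul, div_eq_mul_inv]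
    _ = ENNReal.ofReal M * ∫⁻ q, (∫⁻ t in Ioi (0 : ℝ), f (t, q)) ∂μ := by
        rw [lintegral_const_mul' _ _ ENNReal.ofReal_ne_top, lintegral_lintegral_swap
          (f := fun t q => f (t, q)) mf.aemeasurable]
    _ ≤ ENNReal.ofReal M * ∫⁻ q, 2 ∂μ := by
        refine mul_le_mul_right (lintegral_mono fun q => ?_) _
        by_cases hq : 0 < q - p
        · rw [← lintegral_Ici_div_sq hq, ← lintegral_indicator measurableSet_Ici]
          refine (setLIntegral_le_lintegral _ _).trans (lintegral_mono fun t => ?_)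
          by_cases ht : q - p ≤ 2 * t
          · have hmem : (t, q) ∈ S := ⟨hq, ht⟩
            rw [hf, indicator_of_mem hmem,
              indicator_of_mem (show t ∈ Ici ((q - p) / 2) by rw [mem_Ici]; linarith)]
          · have hmem : (t, q) ∉ S := fun hmem => ht hmem.2
            rw [hf, indicator_of_notMem hmem]
            exact zero_le
        · have h0 : ∀ t, f (t, q) = 0 := fun t =>
            indicator_of_notMem (fun hmem : (t, q) ∈ S => hq hmem.1) _
          simp [h0]
    _ = _ := by rw [lintegral_const]

/-! ### Composition of a function of bounded variation with `h`. -/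

/-- Fubini bound for the change of `ψ` between two curves that cross transversally. -/
theorem lintegral_enorm_sub_le (H : HasLogDeriv h u μ) {ψ : ℝ → ℂ} {ν : Measure ℝ} [SFinite ν]
    (hψ : ∀ a b, a ≤ b → ‖ψ b - ψ a‖ₑ ≤ ν (Ioc a b)) {c : ℝ} (hc : 0 < c) (t : ℝ)
    (hu : ∀ x, c ≤ 2 * Real.exp (u (x + t)) - Real.exp (u (x + 2 * t))) :
    ∫⁻ x, ‖ψ (h x) - ψ (2 * h (x + t) - h (x + 2 * t))‖ₑ ≤
      ∫⁻ q, ENNReal.ofReal (2 / c) *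
        ‖h (h.symm q + 2 * t) - 2 * h (h.symm q + t) + h (h.symm q)‖ₑ ∂ν := by
  have ch := h.continuous
  -- `G x` is the reflection of `h (x + 2t)` in `h (x + t)`. The hypothesis says that `G` has slope
  -- at least `c`, so `G` too crosses each level only once.
  set G : ℝ → ℝ := fun x => 2 * h (x + t) - h (x + 2 * t) with hG
  have cG : Continuous G := by fun_prop
  have mono : ∀ x y, x ≤ y → c * (y - x) ≤ G y - G x := by
    have hd : ∀ z, HasDerivAt (fun z => G z - c * z)
        (2 * Real.exp (u (z + t)) - Real.exp (u (z + 2 * t)) - c * 1) z := fun z =>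
      ((((H.hasDerivAt (z + t)).comp_add_const z t).const_mul 2).sub
        ((H.hasDerivAt (z + 2 * t)).comp_add_const z (2 * t))).sub
        ((hasDerivAt_id z).const_mul c)
    have : Monotone fun z => G z - c * z := by
      apply monotone_of_deriv_nonneg fun z => (hd z).differentiableAt
      intro z
      rw [(hd z).deriv]
      linarith [hu z]
    intro x y hxy
    linarith [this hxy]
  set S : Set (ℝ × ℝ) := {z | (h z.1 < z.2 ∧ z.2 ≤ G z.1) ∨ (G z.1 < z.2 ∧ z.2 ≤ h z.1)} with hS
  have mS : MeasurableSet S := by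
    have mh := ch.measurable
    have mG := cG.measurable
    measurability
  calc ∫⁻ x, ‖ψ (h x) - ψ (G x)‖ₑ ≤ ∫⁻ x, ∫⁻ q, S.indicator 1 (x, q) ∂ν := by
        refine lintegral_mono fun x => ?_
        have e : ∫⁻ q, S.indicator 1 (x, q) ∂ν = ν (Prod.mk x ⁻¹' S) := by
          rw [← lintegral_indicator_one (mS.preimage (measurable_prodMk_left (x := x)))]
          rfl
        rw [e]
        rcases le_total (h x) (G x) with hle | hle
        · rw [enorm_sub_rev]
          exact (hψ _ _ hle).trans (measure_mono fun q hq => Or.inl hq)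
        · exact (hψ _ _ hle).trans (measure_mono fun q hq => Or.inr hq)
    _ = ∫⁻ q, (∫⁻ x, S.indicator 1 (x, q)) ∂ν :=
        lintegral_lintegral_swap (f := fun x q => S.indicator 1 (x, q))
          (measurable_one.indicator mS).aemeasurable
    _ ≤ _ := by
        refine lintegral_mono fun q => ?_
        have e : ∫⁻ x, S.indicator 1 (x, q) = volume ((fun x => (x, q)) ⁻¹' S) := by
          rw [← lintegral_indicator_one (mS.preimage (measurable_prodMk_right (y := q)))]
          rfl
        set p := h.symm q with hp
        have hpq : h p = q := h.apply_symm_apply q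
        have hGp : h (p + 2 * t) - 2 * h (p + t) + h p = q - G p := by rw [hG, hpq]; ring
        rw [e, hGp, Real.enorm_eq_ofReal_abs, ← ENNReal.ofReal_mul (by positivity)]
        -- If `q` separates `h x` from `G x`, then `x` and `p = h⁻¹ q` are ordered so that `q` also
        -- lies between `G x` and `G p`. The slope of `G` then gives `c |x - p| ≤ |q - G p|`, and `q
        -- - G p` is the second difference of `h` at `p`.
        have hsub : (fun x => (x, q)) ⁻¹' S ⊆ Metric.closedBall p (|q - G p| / c) := by
          rintro x hx
          rw [Metric.mem_closedBall, Real.dist_eq, le_div_iff₀ hc]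
          rcases hx with ⟨h1, h2⟩ | ⟨h1, h2⟩
          · simp only at h1 h2
            rw [← hpq, H.strictMono.lt_iff_lt] at h1
            have := mono x p h1.le
            rw [abs_of_nonpos (by linarith)]
            have := neg_abs_le (q - G p)
            nlinarith
          · simp only at h1 h2
            rw [← hpq, H.strictMono.le_iff_le] at h2
            have := mono p x h2
            rw [abs_of_nonneg (by linarith)]
            have := le_abs_self (q - G p)
            nlinarith
        refine (measure_mono hsub).trans (le_of_eq ?_)
        rw [Real.volume_closedBall]
        congr 1
        ring

/-- For fixed `q` the base point `h⁻¹ q` does not depend on `t`, so the `t`-integral can be done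
first by `lintegral_secondDiff_le`. The constant is `(2/c) · M · 2`. -/
theorem lintegral_enorm_sub_reflected_le (H : HasLogDeriv h u μ) [SFinite μ] {ψ : ℝ → ℂ} {ν : Measure ℝ} [SFinite ν]
    (hψ : ∀ a b, a ≤ b → ‖ψ b - ψ a‖ₑ ≤ ν (Ioc a b)) {c M : ℝ} (hc : 0 < c)
    (hu : ∀ x y, c ≤ 2 * Real.exp (u x) - Real.exp (u y)) (hM : ∀ x, Real.exp (u x) ≤ M) :
    ∫⁻ t in Ioi (0 : ℝ), (∫⁻ x, ‖ψ (h x) - ψ (2 * h (x + t) - h (x + 2 * t))‖ₑ) /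
      ENNReal.ofReal (t ^ 2) ≤ ENNReal.ofReal (4 * M / c) * (μ univ * ν univ) := by
  have ch := h.continuous
  have chs := h.symm.continuous
  calc _ ≤ ∫⁻ t in Ioi (0 : ℝ), ∫⁻ q, ENNReal.ofReal (2 / c) *
        (‖h (h.symm q + 2 * t) - 2 * h (h.symm q + t) + h (h.symm q)‖ₑ /
          ENNReal.ofReal (t ^ 2)) ∂ν := by
        refine setLIntegral_mono' measurableSet_Ioi fun t ht => ?_
        refine (ENNReal.div_le_div_right (H.lintegral_enorm_sub_le hψ hc t fun x => hu _ _)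
          _).trans (le_of_eq ?_)
        rw [div_eq_mul_inv, ← lintegral_mul_const' _ _ (inv_ofReal_sq_ne_top ht)]
        simp only [div_eq_mul_inv, mul_assoc]
    _ = ∫⁻ q, (∫⁻ t in Ioi (0 : ℝ), ENNReal.ofReal (2 / c) *
        (‖h (h.symm q + 2 * t) - 2 * h (h.symm q + t) + h (h.symm q)‖ₑ /
          ENNReal.ofReal (t ^ 2))) ∂ν := by
        apply lintegral_lintegral_swap
        apply Measurable.aemeasurable
        have c1 : Continuous fun z : ℝ × ℝ =>
          h (h.symm z.2 + 2 * z.1) - 2 * h (h.symm z.2 + z.1) + h (h.symm z.2) := by fun_prop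
        exact measurable_const.mul (c1.measurable.enorm.div (by fun_prop))
    _ ≤ ∫⁻ q, ENNReal.ofReal (2 / c) * (ENNReal.ofReal M * (2 * μ univ)) ∂ν := by
        refine lintegral_mono fun q => ?_
        rw [lintegral_const_mul' _ _ ENNReal.ofReal_ne_top]
        exact mul_le_mul_right (H.lintegral_secondDiff_le hM _) _
    _ = _ := by
        have hM0 : 0 ≤ M := (Real.exp_pos _).le.trans (hM 0)
        rw [lintegral_const, show 4 * M / c = 2 / c * M * 2 by ring,
          ENNReal.ofReal_mul (by positivity), ENNReal.ofReal_mul (by positivity),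
          ENNReal.ofReal_ofNat]
        ring

/-- With `y = h(x+t)` and `y' = h(x+2t)` the integrand is a function `F(y, y')`, so both sides are
integrals over pairs of points. The kernel costs `M²` and each of the two Jacobians costs `1/m`. -/
theorem lintegral_symmetric_secondDiff_le (H : HasLogDeriv h u μ) {ψ : ℝ → ℂ} (cψ : Continuous ψ) {m M : ℝ} (hm : 0 < m)
    (hmu : ∀ x, m ≤ Real.exp (u x)) (hM : ∀ x, Real.exp (u x) ≤ M) :
    ∫⁻ t in Ioi (0 : ℝ), (∫⁻ x, ‖ψ (h (x + 2 * t)) - 2 * ψ (h (x + t)) +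
      ψ (2 * h (x + t) - h (x + 2 * t))‖ₑ) / ENNReal.ofReal (t ^ 2) ≤
      ENNReal.ofReal ((M / m) ^ 2) *
        ∫⁻ t in Ioi (0 : ℝ), secondDiffNorm ψ t / ENNReal.ofReal (t ^ 2) := by
  have ch := h.continuous
  have hM0 : 0 < M := (Real.exp_pos _).trans_le (hM 0)
  set F : ℝ → ℝ → ℝ≥0∞ := fun y y' => ‖ψ y' - 2 * ψ y + ψ (2 * y - y')‖ₑ with hF
  have mF : Measurable fun z : ℝ × ℝ => F z.1 z.2 := by
    have : Continuous fun z : ℝ × ℝ => ψ z.2 - 2 * ψ z.1 + ψ (2 * z.1 - z.2) := by fun_prop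
    exact this.measurable.enorm
  -- Stated for a general map `k` so that `k = h` and `k = id` rewrite the two sides in the same
  -- coordinates.
  have swap : ∀ k : ℝ → ℝ, Continuous k →
      ∫⁻ t in Ioi (0 : ℝ), (∫⁻ x, F (k x) (k (x + t))) / ENNReal.ofReal (t ^ 2) =
      ∫⁻ x, ∫⁻ y in Ioi x, F (k x) (k y) / ENNReal.ofReal ((y - x) ^ 2) := fun k hk => by
    have mk : Measurable fun z : ℝ × ℝ => F (k z.2) (k (z.2 + z.1)) / ENNReal.ofReal (z.1 ^ 2) := by
      have : Measurable fun z : ℝ × ℝ => (k z.2, k (z.2 + z.1)) := by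
        have := hk.measurable; fun_prop
      exact (mF.comp this).div (by fun_prop)
    calc _ = ∫⁻ t in Ioi (0 : ℝ), ∫⁻ x, F (k x) (k (x + t)) / ENNReal.ofReal (t ^ 2) := by
          refine setLIntegral_congr_fun measurableSet_Ioi fun t ht => ?_
          simp only [div_eq_mul_inv]
          rw [lintegral_mul_const' _ _ (inv_ofReal_sq_ne_top ht)]
      _ = ∫⁻ x, ∫⁻ t in Ioi (0 : ℝ), F (k x) (k (x + t)) / ENNReal.ofReal (t ^ 2) :=
          lintegral_lintegral_swap mk.aemeasurable
      _ = _ := by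
          refine lintegral_congr fun x => ?_
          have := (measurePreserving_add_left volume x).setLIntegral_comp_preimage_emb
            (measurableEmbedding_addLeft x)
            (fun y => F (k x) (k y) / ENNReal.ofReal ((y - x) ^ 2)) (Ioi x)
          rw [← this]
          have hpre : ((fun y => x + y) ⁻¹' Ioi x : Set ℝ) = Ioi 0 := by ext; simp
          rw [hpre]
          simp only [add_sub_cancel_left]
  have lhs : ∀ t : ℝ, ∫⁻ x, ‖ψ (h (x + 2 * t)) - 2 * ψ (h (x + t)) +
      ψ (2 * h (x + t) - h (x + 2 * t))‖ₑ = ∫⁻ x, F (h x) (h (x + t)) := fun t => by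
    rw [← lintegral_add_right_eq_self (fun x => F (h x) (h (x + t))) t]
    refine lintegral_congr fun x => ?_
    rw [hF, show x + t + t = x + 2 * t by ring]
  have rhs : ∀ t : ℝ, secondDiffNorm ψ t = ∫⁻ x, F (id x) (id (x + t)) := fun t => by
    rw [← lintegral_add_right_eq_self (fun x => F (id x) (id (x + t))) t]
    refine lintegral_congr fun x => ?_
    simp only [hF, id]
    rw [show x + t + t = x + 2 * t by ring, show 2 * (x + t) - (x + 2 * t) = x by ring]
  simp only [lhs, rhs]
  rw [swap h ch, swap id continuous_id]
  have himg : ∀ x, h '' Ioi x = Ioi (h x) := fun x => by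
    ext y
    rw [h.image_eq_preimage_symm, mem_preimage, mem_Ioi, mem_Ioi, ← H.strictMono.lt_iff_lt,
      h.apply_symm_apply]
  calc ∫⁻ x, ∫⁻ y in Ioi x, F (h x) (h y) / ENNReal.ofReal ((y - x) ^ 2)
      ≤ ∫⁻ x, ∫⁻ y in Ioi x, ENNReal.ofReal (M ^ 2) *
          (F (h x) (h y) / ENNReal.ofReal ((h y - h x) ^ 2)) := by
        refine lintegral_mono fun x => setLIntegral_mono' measurableSet_Ioi fun y hy => ?_
        have hy0 : 0 < y - x := sub_pos.2 hy
        have hh0 : 0 < h y - h x := sub_pos.2 (H.strictMono hy)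
        have hle := H.sub_le_mul hM hy.le
        rw [div_eq_mul_inv, div_eq_mul_inv, mul_left_comm]
        gcongr
        rw [← ENNReal.ofReal_inv_of_pos (by positivity), ← ENNReal.ofReal_inv_of_pos (by positivity),
          ← ENNReal.ofReal_mul (by positivity)]
        apply ENNReal.ofReal_le_ofReal
        rw [← div_eq_mul_inv, inv_eq_one_div, div_le_div_iff₀ (by positivity) (by positivity),
          one_mul, ← mul_pow]
        gcongr
    _ ≤ ∫⁻ x, ENNReal.ofReal (M ^ 2) * (ENNReal.ofReal m⁻¹ *
          ∫⁻ y in Ioi (h x), F (h x) y / ENNReal.ofReal ((y - h x) ^ 2)) := by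
        refine lintegral_mono fun x => ?_
        rw [lintegral_const_mul' _ _ ENNReal.ofReal_ne_top, ← himg]
        exact mul_le_mul_right (H.setLIntegral_comp_le measurableSet_Ioi hm hmu
          fun y => F (h x) y / ENNReal.ofReal ((y - h x) ^ 2)) _
    _ ≤ ENNReal.ofReal (M ^ 2) * (ENNReal.ofReal m⁻¹ * (ENNReal.ofReal m⁻¹ *
          ∫⁻ x, ∫⁻ y in Ioi x, F x y / ENNReal.ofReal ((y - x) ^ 2))) := by
        rw [lintegral_const_mul' _ _ ENNReal.ofReal_ne_top,
          lintegral_const_mul' _ _ ENNReal.ofReal_ne_top]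
        gcongr
        exact H.lintegral_comp_le hm hmu
          (fun x => ∫⁻ y in Ioi x, F x y / ENNReal.ofReal ((y - x) ^ 2))
    _ = _ := by
        rw [← mul_assoc, ← mul_assoc, ← ENNReal.ofReal_mul (by positivity),
          ← ENNReal.ofReal_mul (by positivity)]
        congr 2
        field_simp

/-- The second-difference norm of `ψ ∘ h` for a continuous `ψ` of bounded variation and a
diffeomorphism `h` with almost constant derivative. -/
theorem besovSharpNorm_comp_le_of_variation (H : HasLogDeriv h u μ) [SFinite μ] {V : ℝ}
    (hV : 0 ≤ V) (hV' : Real.exp V ≤ 3 / 2) (hμ : μ univ ≤ ENNReal.ofReal V) {ψ : ℝ → ℂ}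
    (cψ : Continuous ψ) {ν : Measure ℝ} [SFinite ν]
    (hψ : ∀ a b, a ≤ b → ‖ψ b - ψ a‖ₑ ≤ ν (Ioc a b)) :
    besovSharpNorm (ψ ∘ h) ≤ ENNReal.ofReal (Real.exp (2 * V)) * besovSharpNorm ψ +
      ENNReal.ofReal (24 * V) * ν univ := by
  obtain ⟨m, hm, hu⟩ := H.exists_bounds hV hμ
  have ch := h.continuous
  have hmain := H.lintegral_symmetric_secondDiff_le cψ hm (fun x => (hu x).1) (fun x => (hu x).2)
  -- The slope of the reflected curve is at least `2m - e^V m ≥ m/2`; this is where `e^V ≤ 3/2` is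
  -- needed.
  have herr := H.lintegral_enorm_sub_reflected_le hψ (c := m / 2) (M := Real.exp V * m) (half_pos hm)
    (fun x y => by nlinarith [hu x, hu y]) (fun x => (hu x).2)
  rw [besovSharpNorm_eq_setLIntegral, besovSharpNorm_eq_setLIntegral]
  set P : ℝ → ℝ≥0∞ := fun t => (∫⁻ x, ‖ψ (h (x + 2 * t)) - 2 * ψ (h (x + t)) +
      ψ (2 * h (x + t) - h (x + 2 * t))‖ₑ) / ENNReal.ofReal (t ^ 2) with hP
  set Q : ℝ → ℝ≥0∞ := fun t => (∫⁻ x, ‖ψ (h x) - ψ (2 * h (x + t) - h (x + 2 * t))‖ₑ) /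
      ENNReal.ofReal (t ^ 2) with hQ
  have split : ∫⁻ t in Ioi (0 : ℝ), secondDiffNorm (ψ ∘ h) t / ENNReal.ofReal (t ^ 2) ≤
      (∫⁻ t in Ioi (0 : ℝ), P t) + ∫⁻ t in Ioi (0 : ℝ), Q t := by
    have mP : Measurable P := by
      have c1 : Continuous fun z : ℝ × ℝ => ψ (h (z.2 + 2 * z.1)) - 2 * ψ (h (z.2 + z.1)) +
        ψ (2 * h (z.2 + z.1) - h (z.2 + 2 * z.1)) := by fun_prop
      exact (Measurable.lintegral_prod_right' c1.measurable.enorm).div (by fun_prop)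
    rw [← lintegral_add_left mP]
    refine lintegral_mono fun t => ?_
    rw [hP, hQ, ← ENNReal.add_div, secondDiffNorm, ← lintegral_add_left
      (Continuous.measurable (by fun_prop)).enorm]
    refine ENNReal.div_le_div_right (lintegral_mono fun x => ?_) _
    refine le_trans (le_of_eq ?_) (enorm_add_le _ _)
    congr 1
    simp only [Function.comp_apply]
    ring
  have e1 : Real.exp V * m / m = Real.exp V := by field_simp
  have e2 : 4 * (Real.exp V * m) / (m / 2) = 8 * Real.exp V := by field_simp; ring
  rw [e1, ← Real.exp_nat_mul, Nat.cast_ofNat] at hmain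
  rw [e2] at herr
  -- The constant is `8 e^V ≤ 12`, and it doubles to 24 when negative `t` is included.
  have herr' : ∫⁻ t in Ioi (0 : ℝ), Q t ≤ ENNReal.ofReal (12 * V) * ν univ := by
    refine herr.trans ?_
    rw [← mul_assoc, ENNReal.ofReal_mul (by norm_num : (0 : ℝ) ≤ 12)]
    gcongr
    linarith
  calc _ ≤ 2 * ((ENNReal.ofReal (Real.exp (2 * V)) *
          ∫⁻ t in Ioi (0 : ℝ), secondDiffNorm ψ t / ENNReal.ofReal (t ^ 2)) +
          ENNReal.ofReal (12 * V) * ν univ) := by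
        gcongr
        exact split.trans (add_le_add hmain herr')
    _ = _ := by
        rw [show (24 : ℝ) * V = 2 * (12 * V) by ring, ENNReal.ofReal_mul zero_le_two,
          ENNReal.ofReal_ofNat]
        ring

end HasLogDeriv

/-! ### Steklov means and passage to the limit. -/

/-- The mean of `φ` over `[x, x + ε]`. -/
noncomputable def steklov (φ : ℝ → ℂ) (ε x : ℝ) : ℂ := ε⁻¹ • ∫ s in x..(x + ε), φ s

section Steklov

variable {φ : ℝ → ℂ}

theorem MeasureTheory.LocallyIntegrable.intervalIntegrable_real (hφ : LocallyIntegrable φ)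
    (a b : ℝ) : IntervalIntegrable φ volume a b :=
  intervalIntegrable_iff.2
    ((hφ.integrableOn_isCompact isCompact_uIcc).mono_set uIoc_subset_uIcc)

theorem continuous_steklov (hφ : LocallyIntegrable φ) (ε : ℝ) : Continuous (steklov φ ε) := by
  have hc : Continuous fun x => ∫ s in (0 : ℝ)..x, φ s :=
    intervalIntegral.continuous_primitive hφ.intervalIntegrable_real 0
  have e : steklov φ ε = fun x => ε⁻¹ • ((∫ s in (0 : ℝ)..(x + ε), φ s) - ∫ s in (0 : ℝ)..x, φ s) := by
    ext x
    rw [steklov, intervalIntegral.integral_interval_sub_left (hφ.intervalIntegrable_real _ _)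
      (hφ.intervalIntegrable_real _ _)]
  rw [e]
  fun_prop

theorem MeasureTheory.LocallyIntegrable.comp_add_right (hφ : LocallyIntegrable φ) (ε : ℝ) :
    LocallyIntegrable fun s => φ (s + ε) := by
  rw [locallyIntegrable_iff]
  intro K hK
  have := (measurePreserving_add_right volume ε).integrableOn_image
    (measurableEmbedding_addRight ε) (f := φ) (s := K)
  exact this.1 (hφ.integrableOn_isCompact (hK.image (by fun_prop)))

theorem steklov_sub_steklov (hφ : LocallyIntegrable φ) (ε a b : ℝ) :
    steklov φ ε b - steklov φ ε a = ∫ s in a..b, ε⁻¹ • (φ (s + ε) - φ s) := by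
  have i := hφ.intervalIntegrable_real
  rw [intervalIntegral.integral_smul, intervalIntegral.integral_sub
    ((hφ.comp_add_right ε).intervalIntegrable_real _ _) (i _ _),
    intervalIntegral.integral_comp_add_right, steklov, steklov, ← smul_sub]
  congr 1
  have h1 := intervalIntegral.integral_add_adjacent_intervals (i a b) (i b (b + ε))
  have h2 := intervalIntegral.integral_add_adjacent_intervals (i a (a + ε)) (i (a + ε) (b + ε))
  rw [← h1] at h2
  linear_combination -h2

/-- The derivative of a Steklov mean is a difference quotient of `φ`, so the total variation is its
`L¹` norm. This supplies the measure `ν` for `besovSharpNorm_comp_le_of_variation`. -/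
theorem enorm_steklov_sub_le (hφ : LocallyIntegrable φ) (ε : ℝ) {a b : ℝ} (hab : a ≤ b) :
    ‖steklov φ ε b - steklov φ ε a‖ₑ ≤
      volume.withDensity (fun s => ‖ε⁻¹ • (φ (s + ε) - φ s)‖ₑ) (Ioc a b) := by
  rw [steklov_sub_steklov hφ, intervalIntegral.integral_of_le hab,
    withDensity_apply _ measurableSet_Ioc]
  exact enorm_integral_le_lintegral_enorm _

/-- A Steklov mean is an average of translates of `φ`, and the seminorm is convex and translation
invariant. -/
theorem secondDiffNorm_steklov_le (hφ : LocallyIntegrable φ) (mφ : Measurable φ) {ε : ℝ}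
    (hε : 0 < ε) (t : ℝ) : secondDiffNorm (steklov φ ε) t ≤ secondDiffNorm φ t := by
  have i := fun c => (hφ.comp_add_right c).intervalIntegrable_real
  have shift : ∀ y, ∫ s in y..(y + ε), φ s = ∫ s in (0 : ℝ)..ε, φ (s + y) := fun y => by
    rw [intervalIntegral.integral_comp_add_right, zero_add, add_comm ε]
  have e : ∀ x, steklov φ ε (x + 2 * t) - 2 * steklov φ ε (x + t) + steklov φ ε x =
      ε⁻¹ • ∫ s in Ioc 0 ε, (φ (x + s + 2 * t) - 2 * φ (x + s + t) + φ (x + s)) := fun x => by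
    rw [← intervalIntegral.integral_of_le hε.le]
    have r : ∀ s, φ (x + s + 2 * t) - 2 * φ (x + s + t) + φ (x + s) =
        φ (s + (x + 2 * t)) - 2 * φ (s + (x + t)) + φ (s + x) := fun s => by
      rw [show x + s + 2 * t = s + (x + 2 * t) by ring, show x + s + t = s + (x + t) by ring,
        add_comm x s]
    simp only [r]
    rw [intervalIntegral.integral_add ((i _ _ _).sub ((i _ _ _).const_mul 2)) (i _ _ _),
      intervalIntegral.integral_sub (i _ _ _) ((i _ _ _).const_mul 2),
      intervalIntegral.integral_const_mul, steklov, steklov, steklov, shift, shift, shift,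
      smul_add, smul_sub, mul_smul_comm]
  unfold secondDiffNorm
  calc ∫⁻ x, ‖steklov φ ε (x + 2 * t) - 2 * steklov φ ε (x + t) + steklov φ ε x‖ₑ
      ≤ ∫⁻ x, ENNReal.ofReal ε⁻¹ * ∫⁻ s in Ioc 0 ε,
          ‖φ (x + s + 2 * t) - 2 * φ (x + s + t) + φ (x + s)‖ₑ := by
        refine lintegral_mono fun x => ?_
        rw [e, enorm_smul, Real.enorm_eq_ofReal (by positivity)]
        gcongr
        exact enorm_integral_le_lintegral_enorm _
    _ = ENNReal.ofReal ε⁻¹ * ∫⁻ s in Ioc 0 ε, ∫⁻ x,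
          ‖φ (x + s + 2 * t) - 2 * φ (x + s + t) + φ (x + s)‖ₑ := by
        rw [lintegral_const_mul' _ _ ENNReal.ofReal_ne_top, lintegral_lintegral_swap]
        apply Measurable.aemeasurable
        unfold Function.uncurry
        fun_prop
    _ = ENNReal.ofReal ε⁻¹ * ∫⁻ s in Ioc 0 ε, ∫⁻ x,
          ‖φ (x + 2 * t) - 2 * φ (x + t) + φ x‖ₑ := by
        congr 1
        refine lintegral_congr fun s => ?_
        exact lintegral_add_right_eq_self (fun x => ‖φ (x + 2 * t) - 2 * φ (x + t) + φ x‖ₑ) s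
    _ = _ := by
        rw [setLIntegral_const, Real.volume_Ioc, sub_zero, mul_left_comm,
          ← ENNReal.ofReal_mul (by positivity), inv_mul_cancel₀ hε.ne', ENNReal.ofReal_one, mul_one]

theorem besovSharpNorm_steklov_le (hφ : LocallyIntegrable φ) (mφ : Measurable φ) {ε : ℝ}
    (hε : 0 < ε) : besovSharpNorm (steklov φ ε) ≤ besovSharpNorm φ := by
  rw [besovSharpNorm_eq_setLIntegral, besovSharpNorm_eq_setLIntegral]
  gcongr
  exact secondDiffNorm_steklov_le hφ mφ hε _

theorem ae_tendsto_steklov (hφ : LocallyIntegrable φ) {ε : ℕ → ℝ} (hε : ∀ n, 0 < ε n)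
    (hlim : Tendsto ε atTop (𝓝 0)) :
    ∀ᵐ x, Tendsto (fun n => steklov φ (ε n) x) atTop (𝓝 (φ x)) := by
  filter_upwards [_root_.LocallyIntegrable.ae_hasDerivAt_integral hφ] with x hx
  have h1 := hasDerivAt_iff_tendsto_slope_zero.1 (hx x)
  have h2 : Tendsto ε atTop (𝓝[≠] 0) :=
    tendsto_nhdsWithin_iff.2 ⟨hlim, Eventually.of_forall fun n => (hε n).ne'⟩
  refine (h1.comp h2).congr fun n => ?_
  simp [steklov]

end Steklov

/-- Lower semicontinuity by Fatou's lemma, applied in `x` and then in `t`. -/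
theorem besovSharpNorm_le_of_tendsto_ae {ψ : ℕ → ℝ → ℂ} {φ : ℝ → ℂ} (hψ : ∀ n, Continuous (ψ n))
    (hlim : ∀ᵐ x, Tendsto (fun n => ψ n x) atTop (𝓝 (φ x))) {C : ℝ≥0∞}
    (hC : ∀ n, besovSharpNorm (ψ n) ≤ C) : besovSharpNorm φ ≤ C := by
  set F : (ℝ → ℂ) → ℝ × ℝ → ℝ≥0∞ := fun ψ p =>
    ‖ψ (p.2 + 2 * p.1) - 2 * ψ (p.2 + p.1) + ψ p.2‖ₑ / ENNReal.ofReal (p.1 ^ 2) with hF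
  have mF : ∀ n, Measurable (F (ψ n)) := fun n => measurable_secondDifference (hψ n).measurable
  have hB : ∀ ψ, besovSharpNorm ψ = ∫⁻ t, ∫⁻ x, F ψ (t, x) := fun ψ => rfl
  rw [hB]
  calc ∫⁻ t, ∫⁻ x, F φ (t, x) ≤ ∫⁻ t, ∫⁻ x, liminf (fun n => F (ψ n) (t, x)) atTop := by
        refine lintegral_mono_ae ?_
        filter_upwards [compl_mem_ae_iff.2 (measure_singleton (0 : ℝ))] with t ht
        refine lintegral_mono_ae ?_
        have h1 : ∀ s : ℝ, ∀ᵐ x : ℝ, Tendsto (fun n => ψ n (x + s)) atTop (𝓝 (φ (x + s))) :=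
          fun s => (measurePreserving_add_right volume s).quasiMeasurePreserving.ae hlim
        filter_upwards [hlim, h1 t, h1 (2 * t)] with x hx h2 h3
        refine le_of_eq (Tendsto.liminf_eq ?_).symm
        refine ENNReal.Tendsto.div_const ?_ (Or.inr ?_)
        · exact ((h3.sub (h2.const_mul 2)).add hx).enorm
        · have : t ≠ 0 := ht
          simp [this]
    _ ≤ ∫⁻ t, liminf (fun n => ∫⁻ x, F (ψ n) (t, x)) atTop := by
        refine lintegral_mono fun t => ?_
        exact lintegral_liminf_le fun n => (mF n).comp (measurable_prodMk_left (x := t))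
    _ ≤ liminf (fun n => ∫⁻ t, ∫⁻ x, F (ψ n) (t, x)) atTop :=
        lintegral_liminf_le fun n => (mF n).lintegral_prod_right'
    _ ≤ C := liminf_le_of_frequently_le' (Frequently.of_forall fun n => (hB (ψ n)).symm.trans_le (hC n))

theorem bmoNorm_congr {φ ψ : ℝ → ℂ} (h : φ =ᵐ[volume] ψ) : bmoNorm φ = bmoNorm ψ := by
  unfold bmoNorm
  refine iSup_congr fun a => iSup_congr fun b => iSup_congr fun _ => ?_
  congr 1
  have e : ⨍ y in Icc a b, φ y = ⨍ y in Icc a b, ψ y := by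
    rw [setAverage_eq, setAverage_eq, setIntegral_congr_ae measurableSet_Icc
      (h.mono fun x hx _ => hx)]
  rw [e]
  refine lintegral_congr_ae (ae_restrict_of_ae ?_)
  filter_upwards [h] with x hx
  rw [hx]

/-! ### Growth of the means of a `BMO` function -/

section Growth

variable {φ : ℝ → ℂ}

theorem enorm_average_sub_average_le (hφ : LocallyIntegrable φ) {a b c d : ℝ} (hab : a < b)
    (hca : c ≤ a) (hbd : b ≤ d) (hlen : d - c ≤ 2 * (b - a)) :
    ‖(⨍ y in Icc a b, φ y) - ⨍ y in Icc c d, φ y‖ₑ ≤ 2 * bmoNorm φ := by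
  have hba : 0 < b - a := sub_pos.2 hab
  have iI : IntegrableOn φ (Icc a b) := hφ.integrableOn_isCompact isCompact_Icc
  set m := ⨍ y in Icc c d, φ y with hm
  have vI : volume.real (Icc a b) = b - a := by simp [hab.le]
  have e : (b - a) • ((⨍ y in Icc a b, φ y) - m) = ∫ x in Icc a b, (φ x - m) := by
    rw [integral_sub iI (by simp), setIntegral_const, vI, smul_sub, setAverage_eq, vI, smul_smul,
      mul_inv_cancel₀ hba.ne', one_smul]
  have h1 : ENNReal.ofReal (b - a) * ‖(⨍ y in Icc a b, φ y) - m‖ₑ ≤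
      ENNReal.ofReal (b - a) * (2 * bmoNorm φ) := by
    rw [← Real.enorm_eq_ofReal hba.le, ← enorm_smul, e]
    refine (enorm_integral_le_lintegral_enorm _).trans ?_
    refine (lintegral_mono_set (Icc_subset_Icc hca hbd)).trans ?_
    refine (lintegral_oscillation_le_bmoNorm φ (by linarith)).trans ?_
    rw [← mul_assoc, Real.enorm_eq_ofReal hba.le, mul_comm (ENNReal.ofReal (b - a)) 2,
      ← ENNReal.ofReal_ofNat 2, ← ENNReal.ofReal_mul zero_le_two]
    gcongr
  exact (ENNReal.mul_le_mul_iff_right (by simpa using hab) ENNReal.ofReal_ne_top).1 h1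

/-- Each doubling of the interval costs `2 ‖φ‖_BMO`, so the growth is logarithmic in the length. -/
theorem enorm_average_sub_average_left_le (hφ : LocallyIntegrable φ) (a : ℝ) {L : ℝ} (hL : 0 < L)
    (k : ℕ) : ‖(⨍ y in Icc a (a + L), φ y) - ⨍ y in Icc a (a + 2 ^ k * L), φ y‖ₑ ≤
      k * (2 * bmoNorm φ) := by
  induction k with
  | zero => simp
  | succ k ih =>
    have hk : 0 < 2 ^ k * L := by positivity
    have step := enorm_average_sub_average_le hφ (a := a) (b := a + 2 ^ k * L) (c := a)
      (d := a + 2 ^ (k + 1) * L) (by linarith) le_rfl (by rw [pow_succ]; linarith)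
      (by rw [pow_succ]; linarith)
    rw [← sub_add_sub_cancel _ (⨍ y in Icc a (a + 2 ^ k * L), φ y)]
    refine (enorm_add_le _ _).trans ((add_le_add ih step).trans (le_of_eq ?_))
    push_cast
    ring

theorem enorm_average_sub_average_right_le (hφ : LocallyIntegrable φ) (b : ℝ) {L : ℝ} (hL : 0 < L)
    (k : ℕ) : ‖(⨍ y in Icc (b - L) b, φ y) - ⨍ y in Icc (b - 2 ^ k * L) b, φ y‖ₑ ≤
      k * (2 * bmoNorm φ) := by
  induction k with
  | zero => simp
  | succ k ih =>
    have hk : 0 < 2 ^ k * L := by positivity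
    have step := enorm_average_sub_average_le hφ (a := b - 2 ^ k * L) (b := b)
      (c := b - 2 ^ (k + 1) * L) (d := b) (by linarith) (by rw [pow_succ]; linarith) le_rfl
      (by rw [pow_succ]; linarith)
    rw [← sub_add_sub_cancel _ (⨍ y in Icc (b - 2 ^ k * L) b, φ y)]
    refine (enorm_add_le _ _).trans ((add_le_add ih step).trans (le_of_eq ?_))
    push_cast
    ring

/-- The two short intervals are enlarged to length `2^k L`, one to the right and one to the left, in
`k` doublings each. Both long intervals lie in `[a, a+T+L]`, at most twice as long. -/
theorem enorm_average_sub_average_translate_le (hφ : LocallyIntegrable φ) (a : ℝ) {L : ℝ}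
    (hL : 0 < L) (k : ℕ) :
    ‖(⨍ y in Icc (a + 2 ^ k * L) (a + 2 ^ k * L + L), φ y) - ⨍ y in Icc a (a + L), φ y‖ₑ ≤
      (4 * k + 4) * bmoNorm φ := by
  set T := 2 ^ k * L with hT
  have hLT : L ≤ T := le_mul_of_one_le_left hL.le (one_le_pow₀ one_le_two)
  have h1 := enorm_average_sub_average_left_le hφ a hL k
  have h2 := enorm_average_sub_average_right_le hφ (a + T + L) hL k
  rw [← hT] at h1 h2
  rw [add_sub_cancel_right, show a + T + L - T = a + L by ring] at h2
  have h3 := enorm_average_sub_average_le hφ (a := a) (b := a + T) (c := a) (d := a + T + L)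
    (by linarith) le_rfl (by linarith) (by linarith)
  have h4 := enorm_average_sub_average_le hφ (a := a + L) (b := a + T + L) (c := a)
    (d := a + T + L) (by linarith) (by linarith) le_rfl (by linarith)
  rw [enorm_sub_rev] at h1 h3
  set A := ⨍ y in Icc a (a + L), φ y
  set A' := ⨍ y in Icc (a + T) (a + T + L), φ y
  set E := ⨍ y in Icc a (a + T), φ y
  set E' := ⨍ y in Icc (a + L) (a + T + L), φ y
  set G := ⨍ y in Icc a (a + T + L), φ y
  calc ‖A' - A‖ₑ = ‖(A' - E') + (E' - G) + (G - E) + (E - A)‖ₑ := by congr 1; ring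
    _ ≤ ‖A' - E'‖ₑ + ‖E' - G‖ₑ + ‖G - E‖ₑ + ‖E - A‖ₑ := by
        refine (enorm_add_le _ _).trans (add_le_add ?_ le_rfl)
        refine (enorm_add_le _ _).trans (add_le_add ?_ le_rfl)
        exact enorm_add_le _ _
    _ ≤ k * (2 * bmoNorm φ) + 2 * bmoNorm φ + 2 * bmoNorm φ + k * (2 * bmoNorm φ) := by
        gcongr
    _ = _ := by ring

theorem setLIntegral_enorm_translate_sub_le (hφ : LocallyIntegrable φ) (a : ℝ) {L : ℝ} (hL : 0 < L)
    (k : ℕ) : ∫⁻ x in Icc a (a + L), ‖φ (x + 2 ^ k * L) - φ x‖ₑ ≤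
      ENNReal.ofReal L * ((4 * k + 6) * bmoNorm φ) := by
  set T := 2 ^ k * L with hT
  have h1 := lintegral_oscillation_le_bmoNorm φ (a := a) (b := a + L) (by linarith)
  have h2 := lintegral_oscillation_le_bmoNorm φ (a := a + T) (b := a + T + L) (by linarith)
  have h3 := enorm_average_sub_average_translate_le hφ a hL k
  rw [← hT] at h3
  set A := ⨍ y in Icc a (a + L), φ y
  set A' := ⨍ y in Icc (a + T) (a + T + L), φ y
  rw [add_sub_cancel_left] at h1 h2
  have h2' : ∫⁻ x in Icc a (a + L), ‖φ (x + T) - A'‖ₑ ≤ ENNReal.ofReal L * bmoNorm φ := by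
    refine le_trans (le_of_eq ?_) h2
    rw [← (measurePreserving_add_right volume T).setLIntegral_comp_preimage_emb
      (measurableEmbedding_addRight T) (fun x => ‖φ x - A'‖ₑ) (Icc (a + T) (a + T + L))]
    congr 2
    ext x
    simp only [mem_preimage, mem_Icc]
    constructor <;> rintro ⟨h1, h2⟩ <;> constructor <;> linarith
  have m1 : AEMeasurable (fun x => ‖φ x - A‖ₑ) (volume.restrict (Icc a (a + L))) :=
    (hφ.aestronglyMeasurable.sub aestronglyMeasurable_const).enorm.restrict
  calc ∫⁻ x in Icc a (a + L), ‖φ (x + T) - φ x‖ₑ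
      ≤ ∫⁻ x in Icc a (a + L), (‖φ (x + T) - A'‖ₑ + ‖A' - A‖ₑ + ‖φ x - A‖ₑ) := by
        refine lintegral_mono fun x => ?_
        have e : φ (x + T) - φ x = φ (x + T) - A' + (A' - A) + (A - φ x) := by ring
        rw [e, enorm_sub_rev (φ x)]
        exact (enorm_add_le _ _).trans (add_le_add (enorm_add_le _ _) le_rfl)
    _ = (∫⁻ x in Icc a (a + L), ‖φ (x + T) - A'‖ₑ) + ENNReal.ofReal L * ‖A' - A‖ₑ +
          ∫⁻ x in Icc a (a + L), ‖φ x - A‖ₑ := by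
        rw [lintegral_add_right' _ m1, lintegral_add_right _ measurable_const, setLIntegral_const,
          Real.volume_Icc, add_sub_cancel_left, mul_comm ‖A' - A‖ₑ]
    _ ≤ ENNReal.ofReal L * bmoNorm φ + ENNReal.ofReal L * ((4 * k + 4) * bmoNorm φ) +
          ENNReal.ofReal L * bmoNorm φ := by gcongr
    _ = _ := by ring

end Growth

/-! ### From second differences to first differences. -/

section Doubling

variable {φ : ℝ → ℂ}

/-- The first difference of step `2ε` minus the second difference of step `ε` is twice the first
difference of step `ε`; dividing by `2ε` leaves the difference quotient with factor 1, so the bound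
can be iterated without loss. -/
theorem setLIntegral_enorm_sub_le_doubling (mφ : Measurable φ) (s : Set ℝ) {ε : ℝ} (hε : 0 < ε) :
    ENNReal.ofReal ε⁻¹ * ∫⁻ x in s, ‖φ (x + ε) - φ x‖ₑ ≤
      ENNReal.ofReal (2 * ε)⁻¹ * secondDiffNorm φ ε +
        ENNReal.ofReal (2 * ε)⁻¹ * ∫⁻ x in s, ‖φ (x + 2 * ε) - φ x‖ₑ := by
  have e : ENNReal.ofReal ε⁻¹ = ENNReal.ofReal (2 * ε)⁻¹ * 2 := by
    rw [← ENNReal.ofReal_ofNat 2, ← ENNReal.ofReal_mul (by positivity)]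
    congr 1
    field_simp
  rw [e, mul_assoc, ← mul_add]
  gcongr
  rw [← lintegral_const_mul _ (by fun_prop)]
  calc ∫⁻ x in s, 2 * ‖φ (x + ε) - φ x‖ₑ
      ≤ ∫⁻ x in s, (‖φ (x + 2 * ε) - 2 * φ (x + ε) + φ x‖ₑ + ‖φ (x + 2 * ε) - φ x‖ₑ) := by
        refine lintegral_mono fun x => ?_
        have h2 : (2 : ℝ≥0∞) = ‖(2 : ℂ)‖ₑ := by
          rw [← ofReal_norm]; simp
        rw [h2, ← enorm_mul, add_comm ‖_‖ₑ]
        refine le_trans (le_of_eq ?_) enorm_sub_le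
        congr 1
        ring
    _ ≤ _ := by
        rw [lintegral_add_left (by fun_prop)]
        gcongr
        exact setLIntegral_le_lintegral _ _

theorem setLIntegral_enorm_sub_le_sum (mφ : Measurable φ) (s : Set ℝ) {ε : ℝ} (hε : 0 < ε)
    (n : ℕ) :
    ENNReal.ofReal ε⁻¹ * ∫⁻ x in s, ‖φ (x + ε) - φ x‖ₑ ≤
      (∑ k ∈ Finset.range n, ENNReal.ofReal (2 * (2 ^ k * ε))⁻¹ * secondDiffNorm φ (2 ^ k * ε)) +
        ENNReal.ofReal (2 ^ n * ε)⁻¹ * ∫⁻ x in s, ‖φ (x + 2 ^ n * ε) - φ x‖ₑ := by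
  induction n with
  | zero => simp
  | succ n ih =>
    refine ih.trans ?_
    have := setLIntegral_enorm_sub_le_doubling mφ s (ε := 2 ^ n * ε) (by positivity)
    rw [Finset.sum_range_succ, add_assoc]
    gcongr
    rwa [show 2 * (2 ^ n * ε) = 2 ^ (n + 1) * ε by ring] at this ⊢

theorem tendsto_linear_div_two_pow :
    Tendsto (fun k : ℕ => ENNReal.ofReal ((4 * k + 6) / 2 ^ k)) atTop (𝓝 0) := by
  have h1 := tendsto_pow_const_div_const_pow_of_one_lt 1 (one_lt_two (α := ℝ))
  have h0 := tendsto_pow_const_div_const_pow_of_one_lt 0 (one_lt_two (α := ℝ))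
  have := (h1.const_mul 4).add (h0.const_mul 6)
  rw [← ENNReal.ofReal_zero]
  refine ENNReal.tendsto_ofReal ?_
  convert this using 2
  · field_simp
  · simp

/-- The sum of the `L¹` norms of the second differences along the dyadic multiples of a step. -/
noncomputable def dyadicSecondDiffSum (φ : ℝ → ℂ) (ε : ℝ) : ℝ≥0∞ :=
  ∑' k : ℕ, ENNReal.ofReal (2 * (2 ^ k * ε))⁻¹ * secondDiffNorm φ (2 ^ k * ε)

/-- The remainder of the telescoping is killed on bounded intervals by the logarithmic growth of
means, and the intervals then exhaust the line. Some such condition is needed: `φ(x) = x` has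
vanishing second differences. -/
theorem lintegral_enorm_sub_le_dyadicSecondDiffSum (hφ : LocallyIntegrable φ) (mφ : Measurable φ)
    (hB : bmoNorm φ ≠ ⊤) {ε : ℝ} (hε : 0 < ε) :
    ENNReal.ofReal ε⁻¹ * ∫⁻ x, ‖φ (x + ε) - φ x‖ₑ ≤ dyadicSecondDiffSum φ ε := by
  have local_bound : ∀ j : ℕ, ENNReal.ofReal ε⁻¹ *
      ∫⁻ x in Icc (-(2 ^ j * ε)) (2 ^ j * ε), ‖φ (x + ε) - φ x‖ₑ ≤ dyadicSecondDiffSum φ ε := by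
    intro j
    -- The length is a dyadic multiple of `ε`, so that after `k + j + 1` doublings the step is
    -- exactly `2^k L`.
    set L := 2 ^ (j + 1) * ε with hL
    have L0 : 0 < L := by positivity
    have hI : Icc (-(2 ^ j * ε)) (2 ^ j * ε) = Icc (-(2 ^ j * ε)) (-(2 ^ j * ε) + L) := by
      congr 1
      rw [hL]
      ring
    rw [hI]
    have hk : ∀ k : ℕ, ENNReal.ofReal ε⁻¹ *
        ∫⁻ x in Icc (-(2 ^ j * ε)) (-(2 ^ j * ε) + L), ‖φ (x + ε) - φ x‖ₑ ≤
        dyadicSecondDiffSum φ ε + ENNReal.ofReal ((4 * k + 6) / 2 ^ k) * bmoNorm φ := by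
      intro k
      refine (setLIntegral_enorm_sub_le_sum mφ _ hε (k + (j + 1))).trans
        (add_le_add (ENNReal.sum_le_tsum _) ?_)
      have e : (2 : ℝ) ^ (k + (j + 1)) * ε = 2 ^ k * L := by rw [hL]; ring
      rw [e]
      refine (mul_le_mul_right (setLIntegral_enorm_translate_sub_le hφ _ L0 k) _).trans
        (le_of_eq ?_)
      rw [← mul_assoc, ← mul_assoc]
      congr 1
      have e6 : (4 * (k : ℝ≥0∞) + 6) = ENNReal.ofReal (4 * k + 6) := by
        rw [ENNReal.ofReal_add (by positivity) (by positivity), ENNReal.ofReal_mul (by positivity)]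
        simp
      rw [e6, ← ENNReal.ofReal_mul (by positivity), ← ENNReal.ofReal_mul (by positivity)]
      congr 1
      field_simp
    have lim := (ENNReal.Tendsto.mul_const tendsto_linear_div_two_pow (Or.inr hB)).const_add
      (dyadicSecondDiffSum φ ε)
    rw [zero_mul, add_zero] at lim
    exact ge_of_tendsto' lim hk
  have hlim : Tendsto (fun j : ℕ => (2 : ℝ) ^ j * ε) atTop atTop :=
    (tendsto_pow_atTop_atTop_of_one_lt one_lt_two).atTop_mul_const hε
  have cover : AECover (volume : Measure ℝ) atTop fun j : ℕ => Icc (-(2 ^ j * ε)) (2 ^ j * ε) :=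
    aecover_Icc (tendsto_neg_atTop_atBot.comp hlim) hlim
  have lim := cover.lintegral_tendsto_of_countably_generated
    (f := fun x => ‖φ (x + ε) - φ x‖ₑ) (by fun_prop)
  exact le_of_tendsto' (ENNReal.Tendsto.const_mul lim (Or.inr ENNReal.ofReal_ne_top)) local_bound

theorem setLIntegral_Ioc_comp_mul_left {c : ℝ} (hc : 0 < c) (a b : ℝ) (f : ℝ → ℝ≥0∞) :
    ∫⁻ x in Ioc a b, f (c * x) = ENNReal.ofReal c⁻¹ * ∫⁻ y in Ioc (c * a) (c * b), f y := by
  have := lintegral_image_eq_lintegral_abs_deriv_mul (s := Ioc a b) (f := fun x => c * x)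
    (f' := fun _ => c) measurableSet_Ioc
    (fun x _ => by simpa using ((hasDerivAt_id x).const_mul c).hasDerivWithinAt)
    (fun x _ y _ hxy => mul_left_cancel₀ hc.ne' hxy) f
  rw [image_mul_left_Ioc hc] at this
  rw [this, abs_of_pos hc, lintegral_const_mul' _ _ ENNReal.ofReal_ne_top, ← mul_assoc,
    ← ENNReal.ofReal_mul (by positivity), inv_mul_cancel₀ hc.ne', ENNReal.ofReal_one, one_mul]

theorem measurable_secondDiffNorm (mφ : Measurable φ) : Measurable (secondDiffNorm φ) := by
  unfold secondDiffNorm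
  apply Measurable.lintegral_prod_right'
    (f := fun p : ℝ × ℝ => ‖φ (p.2 + 2 * p.1) - 2 * φ (p.2 + p.1) + φ p.2‖ₑ)
  fun_prop

/-- The substitution `t = 2^k ε` sends `(δ, 2δ]` to disjoint dyadic intervals, so the sum becomes a
single integral over `t`. On the `k`-th interval `t ≤ 2^{k+1} δ`, which turns the weight into `δ /
t²`. -/
theorem setLIntegral_dyadicSecondDiffSum_le (mφ : Measurable φ) {δ : ℝ} (hδ : 0 < δ) :
    ∫⁻ ε in Ioc δ (2 * δ), dyadicSecondDiffSum φ ε ≤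
      ENNReal.ofReal δ * ∫⁻ t in Ioi (0 : ℝ), secondDiffNorm φ t / ENNReal.ofReal (t ^ 2) := by
  have mS := measurable_secondDiffNorm mφ
  unfold dyadicSecondDiffSum
  rw [lintegral_tsum fun k => by fun_prop]
  have term : ∀ k : ℕ, ∫⁻ ε in Ioc δ (2 * δ),
      ENNReal.ofReal (2 * (2 ^ k * ε))⁻¹ * secondDiffNorm φ (2 ^ k * ε) ≤
      ENNReal.ofReal δ * ∫⁻ t in Ioc (2 ^ k * δ) (2 ^ (k + 1) * δ),
        secondDiffNorm φ t / ENNReal.ofReal (t ^ 2) := by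
    intro k
    rw [setLIntegral_Ioc_comp_mul_left (c := 2 ^ k) (by positivity) δ (2 * δ)
      (fun t => ENNReal.ofReal (2 * t)⁻¹ * secondDiffNorm φ t),
      show (2 : ℝ) ^ k * (2 * δ) = 2 ^ (k + 1) * δ by ring,
      ← lintegral_const_mul' _ _ ENNReal.ofReal_ne_top,
      ← lintegral_const_mul' _ _ ENNReal.ofReal_ne_top]
    refine setLIntegral_mono' measurableSet_Ioc fun t ht => ?_
    have ht0 : 0 < t := lt_trans (by positivity) ht.1
    rw [div_eq_mul_inv, ← ENNReal.ofReal_inv_of_pos (by positivity), ← mul_assoc,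
      ← ENNReal.ofReal_mul (by positivity), mul_comm (secondDiffNorm φ t), ← mul_assoc,
      ← ENNReal.ofReal_mul hδ.le]
    refine mul_le_mul_left (ENNReal.ofReal_le_ofReal ?_) _
    rw [← mul_inv, ← div_eq_mul_inv, inv_eq_one_div, div_le_div_iff₀ (by positivity) (by positivity)]
    have h2 : t ≤ 2 ^ k * (2 * δ) := by have := ht.2; rw [pow_succ] at this; linarith
    nlinarith
  refine (ENNReal.tsum_le_tsum term).trans ?_
  rw [ENNReal.tsum_mul_left]
  gcongr
  have hmono : Monotone fun k : ℕ => (2 : ℝ) ^ k * δ := fun i j hij =>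
    mul_le_mul_of_nonneg_right (pow_le_pow_right₀ one_le_two hij) hδ.le
  have hdisj : Pairwise (Function.onFun Disjoint
      fun k : ℕ => Ioc ((2 : ℝ) ^ k * δ) (2 ^ (k + 1) * δ)) := hmono.pairwise_disjoint_on_Ioc_succ
  rw [← lintegral_iUnion (fun k => measurableSet_Ioc) hdisj]
  refine lintegral_mono_set (iUnion_subset fun k t ht => ?_)
  exact lt_trans (by positivity) ht.1

/-- A function in `B̂₁(ℝ)` has arbitrarily small difference quotients which are bounded in `L¹`. -/
theorem exists_lintegral_difference_quotient_le (hφ : LocallyIntegrable φ) (mφ : Measurable φ)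
    (hB : bmoNorm φ ≠ ⊤) {δ : ℝ} (hδ : 0 < δ) :
    ∃ ε ∈ Ioc δ (2 * δ), ∫⁻ x, ‖ε⁻¹ • (φ (x + ε) - φ x)‖ₑ ≤
      ∫⁻ t in Ioi (0 : ℝ), secondDiffNorm φ t / ENNReal.ofReal (t ^ 2) := by
  have vol : volume (Ioc δ (2 * δ)) = ENNReal.ofReal δ := by
    rw [Real.volume_Ioc]; congr 1; ring
  have δ0 : ENNReal.ofReal δ ≠ 0 := by simpa using hδ
  have mS := measurable_secondDiffNorm mφ
  have mR : Measurable (dyadicSecondDiffSum φ) :=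
    Measurable.tsum fun k => by fun_prop
  -- Some `ε` does no worse than the mean over `(δ, 2δ]`, an interval of length `δ`.
  obtain ⟨ε, hε, hle⟩ := exists_le_setLAverage (μ := volume) (s := Ioc δ (2 * δ))
    (by rwa [vol]) (by rw [vol]; exact ENNReal.ofReal_ne_top) mR.aemeasurable.restrict
  have hε0 : 0 < ε := hδ.trans hε.1
  refine ⟨ε, hε, ?_⟩
  calc ∫⁻ x, ‖ε⁻¹ • (φ (x + ε) - φ x)‖ₑ = ENNReal.ofReal ε⁻¹ * ∫⁻ x, ‖φ (x + ε) - φ x‖ₑ := by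
        simp only [enorm_smul, Real.enorm_eq_ofReal (inv_nonneg.2 hε0.le)]
        exact lintegral_const_mul' _ _ ENNReal.ofReal_ne_top
    _ ≤ dyadicSecondDiffSum φ ε := lintegral_enorm_sub_le_dyadicSecondDiffSum hφ mφ hB hε0
    _ ≤ _ := by
        refine hle.trans ?_
        rw [setLAverage_eq, vol]
        exact ENNReal.div_le_of_le_mul' (setLIntegral_dyadicSecondDiffSum_le mφ hδ)

end Doubling

/-! ### The Besov estimate for all of `B̂₁(ℝ)`. -/

namespace HasLogDeriv

variable {h : ℝ ≃ₜ ℝ} {u : ℝ → ℝ} {μ : Measure ℝ} {V : ℝ}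

theorem besovSharpNorm_comp_le_of_measurable (H : HasLogDeriv h u μ) [SFinite μ] (hV : 0 ≤ V)
    (hV' : Real.exp V ≤ 3 / 2) (hμ : μ univ ≤ ENNReal.ofReal V) {φ : ℝ → ℂ}
    (hφ : LocallyIntegrable φ) (mφ : Measurable φ) (hB : bmoNorm φ ≠ ⊤) :
    besovSharpNorm (φ ∘ h) ≤
      ENNReal.ofReal (Real.exp (2 * V) + 12 * V) * besovSharpNorm φ := by
  choose ε hε hle using fun n : ℕ =>
    exists_lintegral_difference_quotient_le hφ mφ hB (Nat.one_div_pos_of_nat (α := ℝ) (n := n))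
  have ε0 : ∀ n, 0 < ε n := fun n => Nat.one_div_pos_of_nat.trans (hε n).1
  have εlim : Tendsto ε atTop (𝓝 0) := by
    refine squeeze_zero (fun n => (ε0 n).le) (fun n => (hε n).2) ?_
    simpa using (tendsto_one_div_add_atTop_nhds_zero_nat (𝕜 := ℝ)).const_mul 2
  refine besovSharpNorm_le_of_tendsto_ae (ψ := fun n => steklov φ (ε n) ∘ h)
    (fun n => (continuous_steklov hφ _).comp h.continuous)
    (H.quasiMeasurePreserving.ae (ae_tendsto_steklov hφ ε0 εlim)) fun n => ?_
  refine (H.besovSharpNorm_comp_le_of_variation hV hV' hμ (continuous_steklov hφ (ε n))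
    fun a b hab => enorm_steklov_sub_le hφ (ε n) hab).trans ?_
  rw [withDensity_apply _ MeasurableSet.univ, setLIntegral_univ,
    ENNReal.ofReal_add (by positivity) (by positivity), add_mul]
  refine add_le_add (mul_le_mul_right (besovSharpNorm_steklov_le hφ mφ (ε0 n)) _) ?_
  refine (mul_le_mul_right (hle n) _).trans (le_of_eq ?_)
  -- The variation is bounded by the integral over `t > 0`, half of the seminorm; hence 24 becomes
  -- 12.
  rw [besovSharpNorm_eq_setLIntegral φ, ← mul_assoc, show 24 * V = 12 * V * 2 by ring,
    ENNReal.ofReal_mul (by positivity), ENNReal.ofReal_ofNat]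

theorem comp_ae_eq (H : HasLogDeriv h u μ) {φ ψ : ℝ → ℂ} (e : φ =ᵐ[volume] ψ) :
    φ ∘ h =ᵐ[volume] ψ ∘ h := H.quasiMeasurePreserving.ae_eq_comp e

theorem besovSharpNorm_comp_le_of_small (H : HasLogDeriv h u μ) [SFinite μ] (hV : 0 ≤ V)
    (hV' : Real.exp V ≤ 3 / 2) (hμ : μ univ ≤ ENNReal.ofReal V) {φ : ℝ → ℂ}
    (hφ : LocallyIntegrable φ) (hB : bmoNorm φ ≠ ⊤) :
    besovSharpNorm (φ ∘ h) ≤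
      ENNReal.ofReal (Real.exp (2 * V) + 12 * V) * besovSharpNorm φ := by
  have mφ := hφ.aestronglyMeasurable
  have e := mφ.ae_eq_mk
  rw [besovSharpNorm_congr e, besovSharpNorm_congr (H.comp_ae_eq e)]
  refine H.besovSharpNorm_comp_le_of_measurable hV hV' hμ (hφ.congr e)
    mφ.stronglyMeasurable_mk.measurable ?_
  rwa [← bmoNorm_congr e]

/-- Induction on `n` by halving `h`: composing the two halves multiplies two equal bounds and
doubles the exponent. The `BMO` estimate keeps the intermediate function admissible. -/
theorem besovSharpNorm_comp_le (n : ℕ) : ∀ {h : ℝ ≃ₜ ℝ} {u : ℝ → ℝ} {μ : Measure ℝ} {V : ℝ}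
    (_ : HasLogDeriv h u μ) (_ : 0 ≤ V) (_ : Real.exp V ≤ 3 / 2)
    (_ : μ univ ≤ ENNReal.ofReal (2 ^ n * V)) {φ : ℝ → ℂ} (_ : LocallyIntegrable φ)
    (_ : bmoNorm φ ≠ ⊤),
    besovSharpNorm (φ ∘ h) ≤
      ENNReal.ofReal ((Real.exp (2 * V) + 12 * V) ^ 2 ^ n) * besovSharpNorm φ := by
  induction n with
  | zero =>
    intro h u μ V H hV hV' hμ φ hφ hB
    rw [pow_zero, one_mul] at hμ
    rw [pow_zero, pow_one]
    have : IsFiniteMeasure μ := ⟨hμ.trans_lt ENNReal.ofReal_lt_top⟩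
    exact H.besovSharpNorm_comp_le_of_small hV hV' hμ hφ hB
  | succ n ih =>
    intro h u μ V H hV hV' hμ φ hφ hB
    rw [pow_succ', mul_assoc] at hμ
    obtain ⟨k, l, v, w, κ, ξ, Hk, Hl, hκ, hξ, hkl⟩ := H.exists_halves (by positivity) hμ
    have e : φ ∘ h = (φ ∘ l) ∘ k := by ext x; simp [hkl]
    have hBl : bmoNorm (φ ∘ l) ≠ ⊤ := ne_top_of_le_ne_top
      (ENNReal.mul_ne_top ENNReal.ofReal_ne_top hB) (Hl.bmoNorm_comp_le (by positivity) hξ hφ)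
    rw [e]
    refine (ih Hk hV hV' hκ (Hl.locallyIntegrable_comp hφ) hBl).trans ?_
    refine (mul_le_mul_right (ih Hl hV hV' hξ hφ hB) _).trans (le_of_eq ?_)
    rw [← mul_assoc, ← ENNReal.ofReal_mul (by positivity), ← pow_add, pow_succ, mul_two]

end HasLogDeriv

/-! ### Distributional derivatives and the regularity of `h`. -/

theorem integral_eq_intervalIntegral_of_zero {f : ℝ → ℝ} {R : ℝ} (hf : ∀ x, R ≤ ‖x‖ → f x = 0) :
    ∫ x, f x = ∫ x in (-R)..R, f x := by
  refine (intervalIntegral.integral_eq_integral_of_support_subset fun x hx => ?_).symm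
  by_contra hn
  refine hx (hf x ?_)
  rw [Real.norm_eq_abs]
  by_contra hlt
  have := abs_lt.1 (not_le.1 hlt)
  exact hn ⟨this.1, this.2.le⟩

/-- The primitive of a locally integrable function has it as its distributional derivative. -/
theorem integral_deriv_mul_primitive {g : ℝ → ℝ} (hg : LocallyIntegrable g) {ψ : ℝ → ℝ}
    (hψ : ContDiff ℝ ∞ ψ) (sψ : HasCompactSupport ψ) :
    ∫ x, deriv ψ x * ∫ t in (0 : ℝ)..x, g t = -∫ x, ψ x * g x := by
  obtain ⟨R₁, h1, z1⟩ := sψ.exists_pos_le_norm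
  obtain ⟨R₂, h2, z2⟩ := sψ.deriv.exists_pos_le_norm
  set R := max R₁ R₂
  have hR : 0 < R := lt_max_of_lt_left h1
  have z1' : ∀ x, R ≤ ‖x‖ → ψ x = 0 := fun x hx => z1 x ((le_max_left _ _).trans hx)
  have z2' : ∀ x, R ≤ ‖x‖ → deriv ψ x = 0 := fun x hx => z2 x ((le_max_right _ _).trans hx)
  have ig : IntervalIntegrable g volume (-R) R := intervalIntegrable_iff.2
    ((hg.integrableOn_isCompact isCompact_uIcc).mono_set uIoc_subset_uIcc)
  have ac1 : AbsolutelyContinuousOnInterval ψ (-R) R :=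
    ContDiffOn.absolutelyContinuousOnInterval (hψ.of_le (by simp)).contDiffOn
  have ac2 := ig.absolutelyContinuousOnInterval_intervalIntegral (c := 0)
    (by rw [uIcc_of_le (by linarith)]; constructor <;> linarith)
  have ibp := ac1.integral_mul_deriv_eq_deriv_mul ac2
  rw [z1' R (by rw [Real.norm_eq_abs, abs_of_pos hR]), z1' (-R) (by simp [abs_of_pos hR]),
    zero_mul, zero_mul, sub_zero, zero_sub] at ibp
  rw [integral_eq_intervalIntegral_of_zero (R := R) fun x hx => by rw [z2' x hx, zero_mul],
    integral_eq_intervalIntegral_of_zero (R := R) fun x hx => by rw [z1' x hx, zero_mul],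
    ← neg_eq_iff_eq_neg, ← ibp]
  refine intervalIntegral.integral_congr_ae ?_
  filter_upwards [_root_.LocallyIntegrable.ae_hasDerivAt_integral hg] with x hx _
  rw [(hx 0).deriv]

/-- A smooth compactly supported function of vanishing integral has a smooth compactly supported
primitive. -/
theorem exists_primitive_of_integral_eq_zero {θ : ℝ → ℝ} (hθ : ContDiff ℝ ∞ θ)
    (sθ : HasCompactSupport θ) (h0 : ∫ x, θ x = 0) :
    ∃ ψ : ℝ → ℝ, ContDiff ℝ ∞ ψ ∧ HasCompactSupport ψ ∧ deriv ψ = θ := by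
  obtain ⟨R, hR, z⟩ := sθ.exists_pos_le_norm
  have cθ := hθ.continuous
  have hd : ∀ x, HasDerivAt (fun x => ∫ t in (-R)..x, θ t) (θ x) x := fun x =>
    intervalIntegral.integral_hasDerivAt_right (cθ.intervalIntegrable _ _)
      cθ.aestronglyMeasurable.stronglyMeasurableAtFilter cθ.continuousAt
  have e : deriv (fun x => ∫ t in (-R)..x, θ t) = θ := funext fun x => (hd x).deriv
  refine ⟨_, contDiff_infty_iff_deriv.2 ⟨fun x => (hd x).differentiableAt, by rwa [e]⟩, ?_, e⟩
  refine HasCompactSupport.intro (isCompact_Icc (a := -R) (b := R)) fun x hx => ?_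
  have hx' : x < -R ∨ R < x := by
    by_contra hn
    push Not at hn
    exact hx hn
  rcases hx' with hlt | hlt
  · refine intervalIntegral.integral_zero_ae (Eventually.of_forall fun t ht => z t ?_)
    rw [uIoc_of_ge hlt.le] at ht
    rw [Real.norm_eq_abs]
    exact le_trans (by linarith [ht.2]) (neg_le_abs t)
  · rw [← intervalIntegral.integral_add_adjacent_intervals (cθ.intervalIntegrable (-R) R)
      (cθ.intervalIntegrable R x), ← integral_eq_intervalIntegral_of_zero z, h0, zero_add]
    refine intervalIntegral.integral_zero_ae (Eventually.of_forall fun t ht => z t ?_)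
    rw [uIoc_of_le hlt.le] at ht
    rw [Real.norm_eq_abs]
    exact ht.1.le.trans (le_abs_self t)

/-- A locally integrable function of vanishing distributional derivative is constant. -/
theorem ae_eq_const_of_integral_deriv_mul_eq_zero {f : ℝ → ℝ} (hf : LocallyIntegrable f)
    (h : ∀ ψ : ℝ → ℝ, ContDiff ℝ ∞ ψ → HasCompactSupport ψ → ∫ x, deriv ψ x * f x = 0) :
    ∃ c : ℝ, ∀ᵐ x, f x = c := by
  let b : ContDiffBump (0 : ℝ) := default
  set η : ℝ → ℝ := b.normed volume with hη
  have cη : ContDiff ℝ ∞ η := b.contDiff_normed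
  have sη : HasCompactSupport η := b.hasCompactSupport_normed
  have iη : ∫ x, η x = 1 := b.integral_normed
  have int : ∀ {ζ : ℝ → ℝ}, ContDiff ℝ ∞ ζ → HasCompactSupport ζ →
      Integrable fun x => ζ x * f x := fun hζ sζ =>
    hf.integrable_smul_left_of_hasCompactSupport hζ.continuous sζ
  refine ⟨∫ x, η x * f x, ae_eq_of_integral_contDiff_smul_eq hf
    continuous_const.locallyIntegrable fun ζ hζ sζ => ?_⟩
  set a := ∫ x, ζ x with ha
  have iζ : Integrable ζ := hζ.continuous.integrable_of_hasCompactSupport sζ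
  have iη' : Integrable η := cη.continuous.integrable_of_hasCompactSupport sη
  -- Subtracting a multiple of a bump of integral 1 makes the test function integrate to zero, hence
  -- a derivative of a test function. The constant is then the pairing of `f` with that bump.
  obtain ⟨ψ, hψ, sψ, e⟩ := exists_primitive_of_integral_eq_zero (θ := fun x => ζ x - a * η x)
    (hζ.sub (contDiff_const.mul cη)) (sζ.sub (sη.mul_left (f := fun _ => a))) (by
      rw [integral_sub iζ (iη'.const_mul a), integral_const_mul, iη, mul_one, sub_self])
  have key := h ψ hψ sψ
  simp only [e, sub_mul, mul_assoc] at key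
  rw [integral_sub (int hζ sζ) ((int cη sη).const_mul a), integral_const_mul, sub_eq_zero] at key
  simp only [smul_eq_mul]
  rw [key, integral_mul_const]

theorem IsWeakDeriv.ae_eq {φ g₁ g₂ : ℝ → ℂ} (h₁ : IsWeakDeriv φ g₁) (h₂ : IsWeakDeriv φ g₂) :
    ∀ᵐ x, g₁ x = g₂ x :=
  ae_eq_of_integral_contDiff_smul_eq h₁.1 h₂.1 fun ψ hψ sψ => by
    rw [← neg_inj, ← h₁.2 ψ hψ sψ, ← h₂.2 ψ hψ sψ]

theorem IsWeakDeriv.sobolevDotNorm_eq {φ g : ℝ → ℂ} (h : IsWeakDeriv φ g) :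
    sobolevDotNorm φ = ∫⁻ x, ‖g x‖ₑ := by
  refine le_antisymm (iInf₂_le g h) (le_iInf₂ fun g' hg' => le_of_eq ?_)
  refine lintegral_congr_ae ?_
  filter_upwards [h.ae_eq hg'] with x hx
  rw [hx]

/-- A real function with an integrable distributional derivative is almost everywhere equal to a
continuous one. -/
theorem exists_continuous_of_isWeakDeriv {f : ℝ → ℝ} {g : ℝ → ℂ}
    (hf : LocallyIntegrable fun x => (f x : ℂ)) (hg : IsWeakDeriv (fun x => (f x : ℂ)) g)
    (ig : Integrable g) : ∃ u : ℝ → ℝ, Continuous u ∧ (∀ᵐ x, f x = u x) ∧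
      ∀ a b, a ≤ b → ‖u b - u a‖ₑ ≤ volume.withDensity (fun x => ‖g x‖ₑ) (Ioc a b) := by
  have igr : Integrable fun x => (g x).re := ig.re
  have lgr : LocallyIntegrable fun x => (g x).re := igr.locallyIntegrable
  have hfr : LocallyIntegrable f := fun x => by
    obtain ⟨s, hs, h⟩ := hf x
    exact ⟨s, hs, h.re⟩
  set G : ℝ → ℝ := fun x => ∫ t in (0 : ℝ)..x, (g t).re with hG
  have cG : Continuous G := intervalIntegral.continuous_primitive
    (fun a b => igr.intervalIntegrable) 0
  have weak : ∀ ψ : ℝ → ℝ, ContDiff ℝ ∞ ψ → HasCompactSupport ψ →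
      ∫ x, deriv ψ x * f x = -∫ x, ψ x * (g x).re := fun ψ hψ sψ => by
    have h1 := congrArg Complex.re (hg.2 ψ hψ sψ)
    have i1 : Integrable fun x => deriv ψ x • (f x : ℂ) :=
      hf.integrable_smul_left_of_hasCompactSupport (hψ.continuous_deriv (by simp)) sψ.deriv
    have i2 : Integrable fun x => ψ x • g x :=
      hg.1.integrable_smul_left_of_hasCompactSupport hψ.continuous sψ
    rw [Complex.neg_re] at h1
    have e1 := integral_re i1
    have e2 := integral_re i2
    simp only [RCLike.re_to_complex] at e1 e2
    rw [← e1, ← e2] at h1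
    simpa using h1
  have sub : ∀ ψ : ℝ → ℝ, ContDiff ℝ ∞ ψ → HasCompactSupport ψ →
      ∫ x, deriv ψ x * (f x - G x) = 0 := fun ψ hψ sψ => by
    have i1 : Integrable fun x => deriv ψ x * f x :=
      hfr.integrable_smul_left_of_hasCompactSupport (hψ.continuous_deriv (by simp)) sψ.deriv
    have i2 : Integrable fun x => deriv ψ x * G x :=
      cG.locallyIntegrable.integrable_smul_left_of_hasCompactSupport
        (hψ.continuous_deriv (by simp)) sψ.deriv
    simp only [mul_sub]
    rw [integral_sub i1 i2, weak ψ hψ sψ, integral_deriv_mul_primitive lgr hψ sψ, sub_self]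
  obtain ⟨c, hc⟩ := ae_eq_const_of_integral_deriv_mul_eq_zero (hfr.sub cG.locallyIntegrable) sub
  refine ⟨fun x => c + G x, by fun_prop, ?_, fun a b hab => ?_⟩
  · filter_upwards [hc] with x hx
    simp only [Pi.sub_apply] at hx
    linarith
  · have e : c + G b - (c + G a) = ∫ t in Ioc a b, (g t).re := by
      rw [← intervalIntegral.integral_of_le hab, add_sub_add_left_eq_sub, hG,
        intervalIntegral.integral_interval_sub_left igr.intervalIntegrable igr.intervalIntegrable]
    rw [e, withDensity_apply _ measurableSet_Ioc]
    refine (enorm_integral_le_lintegral_enorm _).trans (lintegral_mono fun t => ?_)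
    rw [← ofReal_norm, ← ofReal_norm]
    exact ENNReal.ofReal_le_ofReal (Complex.abs_re_le_norm _)

/-- Absolute continuity recovers `h` as the integral of its derivative, and the primitive of a
continuous function is differentiable everywhere. -/
theorem IsLocallyAbsolutelyContinuous.hasDerivAt_of_ae_deriv_eq {h v : ℝ → ℝ}
    (hac : IsLocallyAbsolutelyContinuous h) (hv : Continuous v) (e : ∀ᵐ x, deriv h x = v x)
    (x : ℝ) : HasDerivAt h (v x) x := by
  have hint : h = fun y => h 0 + ∫ t in (0 : ℝ)..y, v t := by
    ext y
    have h1 := (hac 0 y).integral_deriv_eq_sub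
    rw [← sub_eq_iff_eq_add', ← h1]
    exact intervalIntegral.integral_congr_ae (e.mono fun t ht _ => ht)
  rw [hint]
  exact (intervalIntegral.integral_hasDerivAt_right (hv.intervalIntegrable _ _)
    hv.aestronglyMeasurable.stronglyMeasurableAtFilter hv.continuousAt).const_add _

/-- The measure is `|g| dx` with `g` the distributional derivative of `log h'`, so its mass is
exactly the Sobolev seminorm. -/
theorem exists_hasLogDeriv {h : ℝ ≃ₜ ℝ} (hac : IsLocallyAbsolutelyContinuous h)
    (hpos : ∀ᵐ x : ℝ, 0 < deriv h x) (hS : MemSobolevDot (logDerivative h)) :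
    ∃ (u : ℝ → ℝ) (μ : Measure ℝ), HasLogDeriv h u μ ∧
      μ univ ≤ ENNReal.ofReal (sobolevDotNorm (logDerivative h)).toReal := by
  obtain ⟨hloc, g, hg, ig⟩ := hS
  obtain ⟨u, cu, hu, hv⟩ := exists_continuous_of_isWeakDeriv hloc hg ig
  refine ⟨u, volume.withDensity fun x => ‖g x‖ₑ, ⟨?_, cu, hv⟩, ?_⟩
  · refine hac.hasDerivAt_of_ae_deriv_eq (Real.continuous_exp.comp cu) ?_
    filter_upwards [hu, hpos] with x hx hp
    rw [← hx, Real.exp_log hp]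
  · rw [withDensity_apply _ MeasurableSet.univ, setLIntegral_univ, hg.sobolevDotNorm_eq,
      ENNReal.ofReal_toReal ig.2.ne]

/-! ### Smooth bumps belong to `B̂₁(ℝ)` -/

theorem enorm_setAverage_le {φ : ℝ → ℂ} {C : ℝ} (hC : ∀ x, ‖φ x‖ ≤ C) {a b : ℝ} (hab : a < b) :
    ‖⨍ y in Icc a b, φ y‖ₑ ≤ ENNReal.ofReal C := by
  rw [← ofReal_norm]
  refine ENNReal.ofReal_le_ofReal ?_
  have h1 := norm_setIntegral_le_of_norm_le_const (μ := volume) (s := Icc a b) (f := φ) (C := C)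
    (by simp) (fun x _ => hC x)
  have v : volume.real (Icc a b) = b - a := by simp [hab.le]
  rw [v] at h1
  have hba : 0 < b - a := sub_pos.2 hab
  rw [setAverage_eq, v, norm_smul, Real.norm_eq_abs, abs_of_pos (inv_pos.2 hba),
    inv_mul_le_iff₀ hba]
  linarith

theorem bmoNorm_lt_top_of_bounded {φ : ℝ → ℂ} {C : ℝ} (hC : ∀ x, ‖φ x‖ ≤ C) :
    bmoNorm φ < ⊤ := by
  refine lt_of_le_of_lt (b := ENNReal.ofReal C + ENNReal.ofReal C) ?_ (by simp)
  refine iSup_le fun a => iSup_le fun b => iSup_le fun hab => ?_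
  rw [ENNReal.div_le_iff (by simpa using hab) ENNReal.ofReal_ne_top, ← Real.volume_Icc,
    ← setLIntegral_const]
  refine lintegral_mono fun x => ?_
  refine enorm_sub_le.trans (add_le_add ?_ (enorm_setAverage_le hC hab))
  rw [← ofReal_norm]
  exact ENNReal.ofReal_le_ofReal (hC x)

theorem abs_secondDiff_le {f : ℝ → ℝ} (hf : ContDiff ℝ ∞ f) {M : ℝ}
    (hM : ∀ x, ‖deriv (deriv f) x‖ ≤ M) (x : ℝ) {t : ℝ} (ht : 0 ≤ t) :
    |f (x + 2 * t) - 2 * f (x + t) + f x| ≤ M * t ^ 2 := by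
  have d1 : Differentiable ℝ f := hf.differentiable (by simp)
  have d2 : Differentiable ℝ (deriv f) :=
    (contDiff_infty_iff_deriv.1 hf).2.differentiable (by simp)
  have lip : ∀ y z, ‖deriv f z - deriv f y‖ ≤ M * ‖z - y‖ := fun y z =>
    convex_univ.norm_image_sub_le_of_norm_deriv_le (fun w _ => d2 w) (fun w _ => hM w)
      (mem_univ y) (mem_univ z)
  have hF : ∀ y, HasDerivAt (fun y => f (y + t) - f y) (deriv f (y + t) - deriv f y) y := fun y =>
    ((d1 (y + t)).hasDerivAt.comp_add_const y t).sub (d1 y).hasDerivAt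
  have := convex_univ.norm_image_sub_le_of_norm_hasDerivWithin_le
    (fun w _ => (hF w).hasDerivWithinAt) (C := M * t) (fun w _ => by
      have := lip w (w + t)
      rwa [add_sub_cancel_left, Real.norm_of_nonneg ht] at this)
    (mem_univ x) (mem_univ (x + t))
  rw [add_sub_cancel_left, Real.norm_of_nonneg ht, Real.norm_eq_abs] at this
  rw [show x + 2 * t = x + t + t by ring]
  calc _ = |f (x + t + t) - f (x + t) - (f (x + t) - f x)| := by congr 1; ring
    _ ≤ M * t * t := this
    _ = _ := by ring

/-- For `t ≤ 1` the second difference is `O(t²)` on a bounded set, which cancels the kernel. For `t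
> 1` the `L¹` norm of `f` suffices, since `1/t²` is integrable there. -/
theorem besovSharpNorm_lt_top_of_contDiff {f : ℝ → ℝ} (hf : ContDiff ℝ ∞ f)
    (sf : HasCompactSupport f) : besovSharpNorm (fun x => (f x : ℂ)) < ⊤ := by
  obtain ⟨R, hR, z⟩ := sf.exists_pos_le_norm
  obtain ⟨M, hM⟩ := sf.deriv.deriv.exists_bound_of_continuous
    (contDiff_infty_iff_deriv.1 (contDiff_infty_iff_deriv.1 hf).2).2.continuous
  have hM0 : 0 ≤ M := (norm_nonneg _).trans (hM 0)
  set φ : ℝ → ℂ := fun x => (f x : ℂ) with hφ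
  have cφ : Continuous φ := Complex.continuous_ofReal.comp hf.continuous
  have int : Integrable φ := (hf.continuous.integrable_of_hasCompactSupport sf).ofReal
  have mφ : Measurable φ := cφ.measurable
  set N : ℝ≥0∞ := ∫⁻ x, ‖φ x‖ₑ with hN
  have N_top : N < ⊤ := int.2
  have small : ∀ t ∈ Ioc (0 : ℝ) 1,
      -- For `0 < t ≤ 1` the points `x`, `x + t`, `x + 2t` all miss the support once `|x| > R + 2`;
      -- the constant contains the length of that interval.
      secondDiffNorm φ t / ENNReal.ofReal (t ^ 2) ≤ ENNReal.ofReal (M * (2 * (R + 2))) := by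
    intro t ht
    have ht2 : 0 < t ^ 2 := by have := ht.1; positivity
    rw [ENNReal.div_le_iff (by simpa using ht.1.ne') ENNReal.ofReal_ne_top]
    calc secondDiffNorm φ t ≤ ∫⁻ x, (Icc (-(R + 2)) (R + 2)).indicator
          (fun _ => ENNReal.ofReal (M * t ^ 2)) x := by
          refine lintegral_mono fun x => ?_
          by_cases hx : x ∈ Icc (-(R + 2)) (R + 2)
          · rw [indicator_of_mem hx, ← ofReal_norm]
            refine ENNReal.ofReal_le_ofReal ?_
            refine le_trans (le_of_eq ?_) (abs_secondDiff_le hf hM x ht.1.le)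
            rw [← Real.norm_eq_abs, ← Complex.norm_real]
            push_cast
            rfl
          · have hx' : R + 2 < |x| := by
              by_contra hn
              exact hx (abs_le.1 (not_lt.1 hn))
            have zero : ∀ s, 0 ≤ s → s ≤ 2 → φ (x + s) = 0 := fun s h0 h2 => by
              rw [hφ]
              simp only
              rw [z (x + s), Complex.ofReal_zero]
              rw [Real.norm_eq_abs]
              have := abs_sub_abs_le_abs_sub x (-s)
              rw [sub_neg_eq_add, abs_neg, abs_of_nonneg h0] at this
              linarith
            rw [indicator_of_notMem hx, zero (2 * t) (by linarith [ht.1]) (by linarith [ht.2]),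
              zero t ht.1.le (by linarith [ht.2]), ← add_zero x, zero 0 le_rfl zero_le_two]
            simp
      _ = _ := by
          rw [lintegral_indicator_const measurableSet_Icc, Real.volume_Icc,
            ← ENNReal.ofReal_mul (by positivity), ← ENNReal.ofReal_mul (by positivity)]
          congr 1
          ring
  have large : ∀ t, secondDiffNorm φ t ≤ 4 * N := by
    intro t
    have tr : ∀ s, ∫⁻ x, ‖φ (x + s)‖ₑ = N := fun s =>
      lintegral_add_right_eq_self (fun x => ‖φ x‖ₑ) s
    calc secondDiffNorm φ t ≤ ∫⁻ x, (‖φ (x + 2 * t)‖ₑ + 2 * ‖φ (x + t)‖ₑ + ‖φ x‖ₑ) := by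
          refine lintegral_mono fun x => ?_
          refine (enorm_add_le _ _).trans (add_le_add (enorm_sub_le.trans (le_of_eq ?_)) le_rfl)
          rw [enorm_mul]
          congr 2
          rw [← ofReal_norm]
          simp
      _ = 4 * N := by
          rw [lintegral_add_left (by fun_prop), lintegral_add_left (by fun_prop),
            lintegral_const_mul _ (by fun_prop), tr, tr]
          ring
  rw [besovSharpNorm_eq_setLIntegral, ← Ioc_union_Ioi_eq_Ioi zero_le_one]
  refine ENNReal.mul_lt_top (by simp) (lt_of_le_of_lt (lintegral_union_le _ _ _) ?_)
  refine ENNReal.add_lt_top.2 ⟨?_, ?_⟩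
  · refine (setLIntegral_mono' measurableSet_Ioc small).trans_lt ?_
    rw [setLIntegral_const, Real.volume_Ioc]
    exact ENNReal.mul_lt_top ENNReal.ofReal_lt_top ENNReal.ofReal_lt_top
  · have inv := lintegral_Ici_div_sq zero_lt_two
    rw [div_self two_ne_zero] at inv
    calc ∫⁻ t in Ioi (1 : ℝ), secondDiffNorm φ t / ENNReal.ofReal (t ^ 2)
        ≤ ∫⁻ t in Ici (1 : ℝ), 2 * N * (ENNReal.ofReal 2 / ENNReal.ofReal (t ^ 2)) := by
          refine (lintegral_mono_set Ioi_subset_Ici_self).trans (lintegral_mono fun t => ?_)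
          refine (ENNReal.div_le_div_right (large t) _).trans (le_of_eq ?_)
          rw [div_eq_mul_inv, div_eq_mul_inv, ENNReal.ofReal_ofNat]
          ring
      _ = 2 * N * 2 := by
          rw [lintegral_const_mul' _ _ (ENNReal.mul_lt_top (by simp) N_top).ne, inv]
      _ < ⊤ := ENNReal.mul_lt_top (ENNReal.mul_lt_top (by simp) N_top) (by simp)

theorem eqOn_const_of_bmoNorm_eq_zero {φ : ℝ → ℂ} (cφ : Continuous φ) (h0 : bmoNorm φ = 0)
    {a b : ℝ} (hab : a < b) : ∃ c, ∀ x ∈ Ioo a b, φ x = c := by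
  refine ⟨⨍ y in Icc a b, φ y, ?_⟩
  have h1 := lintegral_oscillation_le_bmoNorm φ hab
  rw [h0, mul_zero, nonpos_iff_eq_zero, lintegral_eq_zero_iff
    (by have := cφ.measurable; fun_prop)] at h1
  have h2 : φ =ᵐ[volume.restrict (Ioo a b)] fun _ => ⨍ y in Icc a b, φ y := by
    filter_upwards [ae_restrict_of_ae_restrict_of_subset Ioo_subset_Icc_self h1] with x hx
    rw [Pi.zero_apply, enorm_eq_zero, sub_eq_zero] at hx
    exact hx
  exact Measure.eqOn_open_of_ae_eq h2 isOpen_Ioo cφ.continuousOn continuousOn_const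

theorem exists_memBesovHat_bmoNorm_ne_zero :
    ∃ φ : ℝ → ℂ, MemBesovHat φ ∧ bmoNorm φ ≠ 0 := by
  let b : ContDiffBump (0 : ℝ) := ⟨1, 2, one_pos, one_lt_two⟩
  have cb : Continuous fun x => (b x : ℂ) := Complex.continuous_ofReal.comp b.continuous
  refine ⟨fun x => (b x : ℂ), ⟨cb.locallyIntegrable, besovSharpNorm_lt_top_of_contDiff b.contDiff
    b.hasCompactSupport, bmoNorm_lt_top_of_bounded (C := 1) fun x => ?_⟩, fun h0 => ?_⟩
  · rw [Complex.norm_real, Real.norm_of_nonneg b.nonneg]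
    exact b.le_one
  · obtain ⟨c, hc⟩ := eqOn_const_of_bmoNorm_eq_zero cb h0 (a := -4) (b := 4) (by norm_num)
    have e1 := hc 0 (by norm_num)
    have e2 := hc 3 (by norm_num)
    rw [b.zero_of_le_dist (by rw [Real.dist_eq]; norm_num [b])] at e2
    rw [b.one_of_mem_closedBall (by simp [b]), ← e2] at e1
    simp at e1

/-- Needed for `1 ≤ ‖T‖ ‖T⁻¹‖`, which fails on the zero space. -/
instance : Nontrivial BesovHat := by
  obtain ⟨φ, hφ, h0⟩ := exists_memBesovHat_bmoNorm_ne_zero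
  refine ⟨BesovHat.mk φ hφ, 0, fun e => h0 ?_⟩
  have h1 : ‖BesovHat.mk φ hφ‖ = 0 := by rw [e, norm_zero]
  rw [BesovHat.norm_mk, ENNReal.toReal_eq_zero_iff, add_eq_zero] at h1
  exact h1.resolve_right (ENNReal.add_lt_top.2 hφ.2).ne |>.2

/-! ### The composition operator -/

/-- A bound for the norm of the composition operator in terms of `‖log h'‖` in `Ẇ¹₁(ℝ)`: the
diffeomorphism is split into `2 ^ n` factors with small logarithmic derivative. -/
noncomputable def besovHatCompBound (V : ℝ) : ℝ :=
  (Real.exp (2 * (V / 2 ^ ⌊3 * V⌋₊)) + 12 * (V / 2 ^ ⌊3 * V⌋₊)) ^ 2 ^ ⌊3 * V⌋₊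

/-- For `V < 1/3` no splitting takes place and the bound is `e^{2V} + 12V`. -/
theorem tendsto_besovHatCompBound : Tendsto besovHatCompBound (𝓝[≥] 0) (𝓝 1) := by
  have h1 : Tendsto (fun V : ℝ => Real.exp (2 * V) + 12 * V) (𝓝[≥] 0) (𝓝 1) := by
    have : Continuous fun V : ℝ => Real.exp (2 * V) + 12 * V := by fun_prop
    simpa using this.continuousWithinAt (s := Ici 0) (x := 0).tendsto
  refine h1.congr' ?_
  have : Iio (1 / 3 : ℝ) ∈ 𝓝[≥] (0 : ℝ) := mem_nhdsWithin_of_mem_nhds (Iio_mem_nhds (by norm_num))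
  filter_upwards [this] with V hV
  have h0 : ⌊3 * V⌋₊ = 0 := Nat.floor_eq_zero.2 (by have : V < 1 / 3 := hV; linarith)
  simp [besovHatCompBound, h0]

theorem exp_le_besovHatCompBound {V : ℝ} (hV : 0 ≤ V) :
    Real.exp (2 * V) ≤ besovHatCompBound V := by
  rw [besovHatCompBound]
  set n := ⌊3 * V⌋₊
  calc Real.exp (2 * V) = Real.exp (2 * (V / 2 ^ n)) ^ 2 ^ n := by
        rw [← Real.exp_nat_mul]
        congr 1
        push_cast
        field_simp
    _ ≤ _ := by
        gcongr
        have : 0 ≤ V / 2 ^ n := by positivity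
        linarith

/-- From `3V < n + 1 ≤ 2^n` each factor has variation at most `1/3`, and `e^{1/3} ≤ 3/2` because `e
< 27/8`. -/
theorem exp_div_two_pow_floor_le (V : ℝ) : Real.exp (V / 2 ^ ⌊3 * V⌋₊) ≤ 3 / 2 := by
  set n := ⌊3 * V⌋₊ with hn
  have h1 : 3 * V < n + 1 := Nat.lt_floor_add_one _
  have h2 : (n : ℝ) + 1 ≤ 2 ^ n := by exact_mod_cast Nat.lt_two_pow_self
  have h3 : V / 2 ^ n ≤ 1 / 3 := by
    rw [div_le_iff₀ (by positivity)]
    linarith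
  refine (Real.exp_le_exp.2 h3).trans ?_
  have h4 : Real.exp (1 / 3) ^ 3 ≤ (3 / 2 : ℝ) ^ 3 := by
    rw [← Real.exp_nat_mul]
    norm_num
    linarith [Real.exp_one_lt_d9]
  exact le_of_pow_le_pow_left₀ three_ne_zero (by norm_num) h4

namespace HasLogDeriv

variable {h : ℝ ≃ₜ ℝ} {u : ℝ → ℝ} {μ : Measure ℝ} {V : ℝ}

theorem besovHatNorm_comp_le (H : HasLogDeriv h u μ) (hV : 0 ≤ V)
    (hμ : μ univ ≤ ENNReal.ofReal V) {φ : ℝ → ℂ} (hφ : MemBesovHat φ) :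
    besovHatNorm (φ ∘ h) ≤ ENNReal.ofReal (besovHatCompBound V) * besovHatNorm φ := by
  unfold besovHatNorm
  rw [mul_add]
  refine add_le_add ?_ ?_
  · refine besovSharpNorm_comp_le ⌊3 * V⌋₊ (V := V / 2 ^ ⌊3 * V⌋₊) H (by positivity)
      (exp_div_two_pow_floor_le V) ?_ hφ.1 hφ.2.2.ne
    rwa [mul_div_cancel₀ V (by positivity)]
  · exact (H.bmoNorm_comp_le hV hμ hφ.1).trans
      (mul_le_mul_left (ENNReal.ofReal_le_ofReal (exp_le_besovHatCompBound hV)) _)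

theorem memBesovHat_comp (H : HasLogDeriv h u μ) (hV : 0 ≤ V)
    (hμ : μ univ ≤ ENNReal.ofReal V) {φ : ℝ → ℂ} (hφ : MemBesovHat φ) :
    MemBesovHat (φ ∘ h) :=
  ⟨H.locallyIntegrable_comp hφ.1, ENNReal.add_lt_top.1 ((H.besovHatNorm_comp_le hV hμ hφ).trans_lt
    (ENNReal.mul_lt_top ENNReal.ofReal_lt_top (ENNReal.add_lt_top.2 hφ.2)))⟩

/-- Composition with `h` on the functions in `B_1^#(ℝ) ∩ BMO(ℝ)`. -/
noncomputable def compFun (H : HasLogDeriv h u μ) (hV : 0 ≤ V) (hμ : μ univ ≤ ENNReal.ofReal V) :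
    BesovHatFun →L[ℂ] BesovHatFun :=
  LinearMap.mkContinuous
    { toFun := fun φ => BesovHatFun.of (φ.toFun ∘ h) (H.memBesovHat_comp hV hμ φ.mem)
      map_add' := fun _ _ => rfl
      map_smul' := fun _ _ => rfl }
    (besovHatCompBound V) fun φ => by
      have hK := (Real.exp_pos _).le.trans (exp_le_besovHatCompBound hV)
      have := ENNReal.toReal_mono (ENNReal.mul_ne_top ENNReal.ofReal_ne_top φ.besovHatNorm_ne_top)
        (H.besovHatNorm_comp_le hV hμ φ.mem)
      rwa [ENNReal.toReal_mul, ENNReal.toReal_ofReal hK] at this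

theorem norm_compFun_le (H : HasLogDeriv h u μ) (hV : 0 ≤ V) (hμ : μ univ ≤ ENNReal.ofReal V)
    (φ : BesovHatFun) : ‖H.compFun hV hμ φ‖ ≤ besovHatCompBound V * ‖φ‖ := by
  have hK := (Real.exp_pos _).le.trans (exp_le_besovHatCompBound hV)
  exact ContinuousLinearMap.le_of_opNorm_le _ (LinearMap.mkContinuous_norm_le _ hK _) φ

/-- Composition with `h` on `B̂₁(ℝ)`. -/
noncomputable def comp (H : HasLogDeriv h u μ) (hV : 0 ≤ V) (hμ : μ univ ≤ ENNReal.ofReal V) :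
    BesovHat →L[ℂ] BesovHat :=
  SeparationQuotient.liftCLM ((SeparationQuotient.mkCLM ℂ BesovHatFun).comp (H.compFun hV hμ))
    fun _ _ hxy => SeparationQuotient.mk_eq_mk.2 (hxy.map (H.compFun hV hμ).continuous)

theorem comp_mk (H : HasLogDeriv h u μ) (hV : 0 ≤ V) (hμ : μ univ ≤ ENNReal.ofReal V)
    (φ : ℝ → ℂ) (hφ : MemBesovHat φ) :
    H.comp hV hμ (BesovHat.mk φ hφ) = BesovHat.mk (φ ∘ h) (H.memBesovHat_comp hV hμ hφ) := rfl

theorem norm_comp_le (H : HasLogDeriv h u μ) (hV : 0 ≤ V) (hμ : μ univ ≤ ENNReal.ofReal V) :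
    ‖H.comp hV hμ‖ ≤ besovHatCompBound V := by
  refine ContinuousLinearMap.opNorm_le_bound _
    ((Real.exp_pos _).le.trans (exp_le_besovHatCompBound hV)) fun q => ?_
  obtain ⟨φ, rfl⟩ := SeparationQuotient.surjective_mk q
  exact H.norm_compFun_le hV hμ φ

theorem comp_comp_eq (H : HasLogDeriv h u μ) (hV : 0 ≤ V) (hμ : μ univ ≤ ENNReal.ofReal V)
    {k : ℝ ≃ₜ ℝ} {v : ℝ → ℝ} {κ : Measure ℝ} (H' : HasLogDeriv k v κ)
    (hκ : κ univ ≤ ENNReal.ofReal V) (hhk : ∀ x, h (k x) = x) (q : BesovHat) :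
    H'.comp hV hκ (H.comp hV hμ q) = q := by
  obtain ⟨φ, rfl⟩ := SeparationQuotient.surjective_mk q
  refine congrArg SeparationQuotient.mk (Subtype.ext (funext fun x => ?_))
  exact congrArg φ.toFun (hhk x)

end HasLogDeriv

theorem mainTheorem6 :
    ∃ K : ℝ → ℝ, Tendsto K (𝓝[≥] 0) (𝓝 1) ∧
      ∀ h : ℝ ≃ₜ ℝ, IsQuasisymmetric h → IsLocallyAbsolutelyContinuous h →
        (∀ᵐ x : ℝ, 0 < deriv h x) → MemSobolevDot (logDerivative h) →
        ∃ T : BesovHat ≃L[ℂ] BesovHat,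
          (∀ (φ : ℝ → ℂ) (hφ : MemBesovHat φ), ∃ hφh : MemBesovHat (φ ∘ h),
            T (BesovHat.mk φ hφ) = BesovHat.mk (φ ∘ h) hφh) ∧
          ‖(T : BesovHat →L[ℂ] BesovHat)‖ ≤ K (sobolevDotNorm (logDerivative h)).toReal ∧
          (K (sobolevDotNorm (logDerivative h)).toReal)⁻¹ ≤
            ‖(T : BesovHat →L[ℂ] BesovHat)‖ := by
  refine ⟨besovHatCompBound, tendsto_besovHatCompBound, fun h _ hac hpos hS => ?_⟩
  obtain ⟨u, μ, H, hμ⟩ := exists_hasLogDeriv hac hpos hS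
  have hV := ENNReal.toReal_nonneg (a := sobolevDotNorm (logDerivative h))
  set V := (sobolevDotNorm (logDerivative h)).toReal
  have hμ' : μ.map h univ ≤ ENNReal.ofReal V := by rwa [HasLogDeriv.map_univ]
  have hK : 0 < besovHatCompBound V := (Real.exp_pos _).trans_le (exp_le_besovHatCompBound hV)
  let T : BesovHat ≃L[ℂ] BesovHat :=
    ContinuousLinearEquiv.equivOfInverse (H.comp hV hμ) (H.symm.comp hV hμ')
      (H.comp_comp_eq hV hμ H.symm hμ' h.apply_symm_apply)
      (H.symm.comp_comp_eq hV hμ' H hμ h.symm_apply_apply)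
  refine ⟨T, fun φ hφ => ⟨H.memBesovHat_comp hV hμ hφ, H.comp_mk hV hμ φ hφ⟩,
    H.norm_comp_le hV hμ, ?_⟩
  -- The inverse is composition with `h⁻¹`, bounded by the same `K`; the lower bound for `‖T‖`
  -- follows.
  have h1 : 1 ≤ ‖(T : BesovHat →L[ℂ] BesovHat)‖ * ‖(T.symm : BesovHat →L[ℂ] BesovHat)‖ :=
    T.one_le_norm_mul_norm_symm
  have h2 : ‖(T.symm : BesovHat →L[ℂ] BesovHat)‖ ≤ besovHatCompBound V :=
    H.symm.norm_comp_le hV hμ'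
  rw [inv_le_iff_one_le_mul₀ hK]
  exact h1.trans (mul_le_mul_of_nonneg_left h2 (norm_nonneg _))
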